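/- Let $?:[0,1]\to[0,1]$ be the Minkowski question mark function, i.e. the continuous increasing function with $?(0)=0$, $?(1)=1$ and $?\left(\frac{p+p'}{q+q'}\right)=\frac12\left(?\left(\frac pq\right)+?\left(\frac{p'}{q'}\right)\right)$ for consecutive Farey fractions $\frac pq,\frac{p'}{q'}$. For an irrational $x=[0;a_1,a_2,\dots]\in(0,1)$ (regular continued fraction) put $S_x(t)=a_1+\dots+a_t$, and for an integer $n$ let $E_n$ be the set of irrational $x\in(0,1)$ all of whose partial quotients satisfy $a_j\le n$. Put $\lambda_1=\frac{1+\sqrt5}{2}$, $\mu_n=\frac{n+2+\sqrt{n^2+4n}}{2}$ and, for $n\ge5$, $$\kappa_n=\frac{(n+1)\log\lambda_1-\log\mu_n}{(n-1)\log\sqrt2-\log\mu_n+2\log\lambda_1}.$$ Let $n\ge 5$ be an integer. (i) Let $x\in E_n$, and suppose that for some constant $C$ one has $S_x(t)\le\kappa_n t+C$ for all integers $t\ge1$. Then $?'(x)$ exists and $?'(x)=+\infty$, that is, $\frac{?(y)-?(x)}{y-x}\to+\infty$ as $y\to x$. (ii) Let $\psi$ be a non-decreasing real function on the positive integers with $\lim_{t\to+\infty}\psi(t)=+\infty$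 and $\psi(1)\ge1-\kappa_n$ (for instance any such $\psi\ge0$, since $\kappa_n>1$). Then there is an $x\in E_n$ such that $?'(x)$ does not exist (the quotient $\frac{?(y)-?(x)}{y-x}$ has no finite or infinite limit as $y\to x$) and $S_x(t)\le\kappa_n t+\psi(t)$ for all integers $t\ge1$. -/

import Mathlib

open Set Filter Topology

noncomputable section

/-! ### The Minkowski question mark function -/

/-- `sternBrocot n j = (p, q)` is the numerator and the denominator of the `j`-th element
(`0 ≤ j ≤ 2 ^ n`, in increasing order) of the Stern-Brocot sequence `F_n`:
`F_0 = {0/1, 1/1}`, and `F_(n+1)` arises from `F_n` by inserting the mediant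
`(p + p') / (q + q')` between any two consecutive elements `p/q` and `p'/q'`. -/
def sternBrocot : ℕ → ℕ → ℕ × ℕ
  | 0, j => if j = 0 then (0, 1) else (1, 1)
  | n + 1, j =>
    if Even j then sternBrocot n (j / 2)
    else sternBrocot n (j / 2) + sternBrocot n (j / 2 + 1)

/-- The `j`-th element of the `n`-th Stern-Brocot sequence, as a real number. -/
def sternBrocotFrac (n j : ℕ) : ℝ := ((sternBrocot n j).1 : ℝ) / ((sternBrocot n j).2 : ℝ)

/-- The Minkowski question mark function. The rule `?(0) = 0`, `?(1) = 1`,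
`?((p + p') / (q + q')) = (?(p/q) + ?(p'/q')) / 2` for consecutive Farey fractions gives the value
`j / 2 ^ n` to the `j`-th element of the `n`-th Stern-Brocot sequence, and the function is extended
from these fractions to all of `[0, 1]` by monotonicity and continuity
(to the left of `0` it is `0`, to the right of `1` it is `1`). -/
def minkowskiQuestion (x : ℝ) : ℝ :=
  sSup {y : ℝ | ∃ n j : ℕ, j ≤ 2 ^ n ∧ sternBrocotFrac n j ≤ x ∧ y = (j : ℝ) / 2 ^ n}

/-! ### Derivatives with values in the extended reals -/

/-- The derivative of `f` at `x` exists in the extended real line and equals `L`: the difference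
quotient `(f y - f x) / (y - x)` tends to `L` as `y → x`, `y ≠ x`. -/
def HasExtendedDerivAt (f : ℝ → ℝ) (L : EReal) (x : ℝ) : Prop :=
  Tendsto (fun y : ℝ => (((f y - f x) / (y - x) : ℝ) : EReal)) (𝓝[≠] x) (𝓝 L)

/-! ### Continued fractions -/

/-- `partialQuotient x j` is the partial quotient `a_(j+1)` of the regular continued fraction
`x = [a_0; a_1, a_2, ...]` of a real number `x` (for irrational `x` all of them exist). -/
def partialQuotient (x : ℝ) (j : ℕ) : ℝ := ((GenContFract.of x).partDens.get? j).getD 0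

/-- `S_x(t) = a_1 + ... + a_t`. -/
def partialQuotientSum (x : ℝ) (t : ℕ) : ℝ := ∑ j ∈ Finset.range t, partialQuotient x j

/-- `E_n`: the irrational numbers in `(0, 1)` all of whose partial quotients `a_1, a_2, ...` are
at most `n`. -/
def boundedTypeSet (n : ℕ) : Set ℝ :=
  {x | Irrational x ∧ x ∈ Ioo (0 : ℝ) 1 ∧ ∀ j, partialQuotient x j ≤ n}

/-! ### The constant -/

/-- `λ_j = (j + √(j² + 4)) / 2`. -/
def lambdaConst (j : ℕ) : ℝ := ((j : ℝ) + Real.sqrt ((j : ℝ) ^ 2 + 4)) / 2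

/-- `μ_j = (j + 2 + √(j² + 4 j)) / 2`. -/
def muConst (j : ℕ) : ℝ := ((j : ℝ) + 2 + Real.sqrt ((j : ℝ) ^ 2 + 4 * (j : ℝ))) / 2

/-- `κ_n = ((n+1) log λ_1 - log μ_n) / ((n-1) log √2 - log μ_n + 2 log λ_1)`, for `n ≥ 5`. -/
def kappaConst (n : ℕ) : ℝ :=
  (((n : ℝ) + 1) * Real.log (lambdaConst 1) - Real.log (muConst n)) /
    (((n : ℝ) - 1) * Real.log (Real.sqrt 2) - Real.log (muConst n) + 2 * Real.log (lambdaConst 1))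

/-! ### The question mark function is the intended one

It takes the value `j / 2 ^ n` at the `j`-th element of the `n`-th Stern-Brocot sequence, so that
it obeys the mediant rule, and it is monotone and continuous. -/

theorem sternBrocot_even (n i : ℕ) : sternBrocot (n + 1) (2 * i) = sternBrocot n i := by
  simp [sternBrocot]

theorem sternBrocot_odd (n i : ℕ) :
    sternBrocot (n + 1) (2 * i + 1) = sternBrocot n i + sternBrocot n (i + 1) := by
  have h : (2 * i + 1) / 2 = i := by omega
  have h' : ¬ Even (2 * i + 1) := by simp
  simp only [sternBrocot, if_neg h', h]

theorem sternBrocot_den_pos (n j : ℕ) : 0 < (sternBrocot n j).2 := by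
  induction n generalizing j with
  | zero => simp only [sternBrocot]; split_ifs <;> simp
  | succ n ih =>
    simp only [sternBrocot]
    split_ifs
    · exact ih _
    · exact Nat.add_pos_left (ih _) _

theorem sternBrocot_det (n j : ℕ) (hj : j < 2 ^ n) :
    (sternBrocot n (j + 1)).1 * (sternBrocot n j).2 =
      (sternBrocot n j).1 * (sternBrocot n (j + 1)).2 + 1 := by
  induction n generalizing j with
  | zero =>
    have : j = 0 := by simpa using hj
    subst this
    simp [sternBrocot]
  | succ n ih =>
    rw [pow_succ] at hj
    obtain ⟨i, rfl | rfl⟩ : ∃ i, j = 2 * i ∨ j = 2 * i + 1 := ⟨j / 2, by omega⟩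
    · have h := ih i (by omega)
      rw [sternBrocot_odd, sternBrocot_even, Prod.fst_add, Prod.snd_add]
      nlinarith
    · have h := ih i (by omega)
      rw [show 2 * i + 1 + 1 = 2 * (i + 1) by ring, sternBrocot_odd, sternBrocot_even,
        Prod.fst_add, Prod.snd_add]
      nlinarith

theorem sternBrocotFrac_lt_succ (n j : ℕ) (hj : j < 2 ^ n) :
    sternBrocotFrac n j < sternBrocotFrac n (j + 1) := by
  have h0 : (0 : ℝ) < ((sternBrocot n j).2 : ℝ) := by exact_mod_cast sternBrocot_den_pos n j
  have h1 : (0 : ℝ) < ((sternBrocot n (j + 1)).2 : ℝ) := by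
    exact_mod_cast sternBrocot_den_pos n (j + 1)
  rw [sternBrocotFrac, sternBrocotFrac, div_lt_div_iff₀ h0 h1]
  have h := sternBrocot_det n j hj
  exact_mod_cast (by omega : (sternBrocot n j).1 * (sternBrocot n (j + 1)).2 <
    (sternBrocot n (j + 1)).1 * (sternBrocot n j).2)

theorem sternBrocotFrac_lt (n j k : ℕ) (hjk : j < k) (hk : k ≤ 2 ^ n) :
    sternBrocotFrac n j < sternBrocotFrac n k := by
  induction k, hjk using Nat.le_induction with
  | base => exact sternBrocotFrac_lt_succ n j hk
  | succ k _ ih => exact (ih (by omega)).trans (sternBrocotFrac_lt_succ n k hk)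

theorem sternBrocotFrac_refine (n j m : ℕ) :
    sternBrocotFrac (n + m) (2 ^ m * j) = sternBrocotFrac n j := by
  induction m with
  | zero => simp
  | succ m ih =>
    rw [← ih, sternBrocotFrac, sternBrocotFrac, ← add_assoc,
      show 2 ^ (m + 1) * j = 2 * (2 ^ m * j) by ring, sternBrocot_even]

theorem le_of_sternBrocotFrac_le {n j m k : ℕ} (hj : j ≤ 2 ^ n)
    (h : sternBrocotFrac n j ≤ sternBrocotFrac m k) : (j : ℝ) / 2 ^ n ≤ (k : ℝ) / 2 ^ m := by
  rw [← sternBrocotFrac_refine n j m, ← sternBrocotFrac_refine m k n, add_comm m n] at h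
  have hle : 2 ^ m * j ≤ 2 ^ n * k := by
    by_contra hlt
    push Not at hlt
    have hb : 2 ^ m * j ≤ 2 ^ (n + m) := by
      rw [pow_add, mul_comm]
      exact Nat.mul_le_mul_right _ hj
    exact absurd h (not_le.mpr (sternBrocotFrac_lt _ _ _ hlt hb))
  rw [div_le_div_iff₀ (by positivity) (by positivity)]
  have : ((2 ^ m * j : ℕ) : ℝ) ≤ ((2 ^ n * k : ℕ) : ℝ) := by exact_mod_cast hle
  push_cast at this
  linarith

theorem minkowskiQuestion_bddAbove (x : ℝ) :
    BddAbove {y : ℝ | ∃ n j : ℕ, j ≤ 2 ^ n ∧ sternBrocotFrac n j ≤ x ∧ y = (j : ℝ) / 2 ^ n} := by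
  refine ⟨1, ?_⟩
  rintro y ⟨n, j, hj, -, rfl⟩
  rw [div_le_one (by positivity)]
  exact_mod_cast hj

theorem minkowskiQuestion_sternBrocotFrac (n j : ℕ) (hj : j ≤ 2 ^ n) :
    minkowskiQuestion (sternBrocotFrac n j) = (j : ℝ) / 2 ^ n := by
  refine le_antisymm (csSup_le ⟨_, n, j, hj, le_rfl, rfl⟩ ?_)
    (le_csSup (minkowskiQuestion_bddAbove _) ⟨n, j, hj, le_rfl, rfl⟩)
  rintro y ⟨m, k, hk, hle, rfl⟩
  exact le_of_sternBrocotFrac_le hk hle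

theorem minkowskiQuestion_nonneg (x : ℝ) : 0 ≤ minkowskiQuestion x := by
  apply Real.sSup_nonneg
  rintro y ⟨n, j, -, -, rfl⟩
  positivity

theorem minkowskiQuestion_le_one (x : ℝ) : minkowskiQuestion x ≤ 1 := by
  refine Real.sSup_le ?_ zero_le_one
  rintro y ⟨n, j, hj, -, rfl⟩
  rw [div_le_one (by positivity)]
  exact_mod_cast hj

theorem minkowskiQuestion_monotone : Monotone minkowskiQuestion := by
  intro x y hxy
  refine Real.sSup_le ?_ (minkowskiQuestion_nonneg y)
  rintro _ ⟨n, j, hj, hle, rfl⟩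
  exact le_csSup (minkowskiQuestion_bddAbove y) ⟨n, j, hj, hle.trans hxy, rfl⟩

theorem exists_minkowskiQuestion_mem_Ioo {a b : ℝ} (ha : 0 ≤ a) (hab : a < b) (hb : b ≤ 1) :
    ∃ x, minkowskiQuestion x ∈ Ioo a b := by
  obtain ⟨n, hn⟩ := exists_pow_lt_of_lt_one (sub_pos.mpr hab) (by norm_num : (1 / 2 : ℝ) < 1)
  have h2 : (0 : ℝ) < 2 ^ n := by positivity
  have hn' : 1 < (b - a) * 2 ^ n := by
    rw [one_div, inv_pow] at hn
    rw [inv_lt_iff_one_lt_mul₀ h2] at hn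
    linarith
  have hfl := Nat.lt_floor_add_one (a * 2 ^ n)
  have hfl' := Nat.floor_le (mul_nonneg ha h2.le)
  have hlt : ((⌊a * 2 ^ n⌋₊ + 1 : ℕ) : ℝ) < b * 2 ^ n := by push_cast; nlinarith
  have hj : ⌊a * 2 ^ n⌋₊ + 1 ≤ 2 ^ n := by
    have : ((⌊a * 2 ^ n⌋₊ + 1 : ℕ) : ℝ) ≤ ((2 ^ n : ℕ) : ℝ) := by push_cast at hlt ⊢; nlinarith
    exact_mod_cast this
  refine ⟨sternBrocotFrac n (⌊a * 2 ^ n⌋₊ + 1), ?_⟩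
  rw [minkowskiQuestion_sternBrocotFrac n _ hj]
  exact ⟨by rw [lt_div_iff₀ h2]; push_cast; exact hfl, by rwa [div_lt_iff₀ h2]⟩

theorem minkowskiQuestion_continuous : Continuous minkowskiQuestion := by
  rw [continuous_iff_continuousAt]
  intro a
  rw [Metric.continuousAt_iff']
  intro ε hε
  have hr : ∀ᶠ y in 𝓝 a, minkowskiQuestion y < minkowskiQuestion a + ε := by
    by_cases h : minkowskiQuestion a + ε ≤ 1
    · obtain ⟨c, hc, hc'⟩ := exists_minkowskiQuestion_mem_Ioo (minkowskiQuestion_nonneg a)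
        (lt_add_of_pos_right _ hε) h
      filter_upwards [Iio_mem_nhds (minkowskiQuestion_monotone.reflect_lt hc)] with y hy
      exact (minkowskiQuestion_monotone (le_of_lt hy)).trans_lt hc'
    · exact Eventually.of_forall fun y =>
        (minkowskiQuestion_le_one y).trans_lt (not_le.mp h)
  have hl : ∀ᶠ y in 𝓝 a, minkowskiQuestion a - ε < minkowskiQuestion y := by
    by_cases h : 0 ≤ minkowskiQuestion a - ε
    · obtain ⟨c, hc, hc'⟩ := exists_minkowskiQuestion_mem_Ioo h
        (sub_lt_self _ hε) (minkowskiQuestion_le_one a)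
      filter_upwards [Ioi_mem_nhds (minkowskiQuestion_monotone.reflect_lt hc')] with y hy
      exact hc.trans_le (minkowskiQuestion_monotone (le_of_lt hy))
    · exact Eventually.of_forall fun y =>
        (not_le.mp h).trans_le (minkowskiQuestion_nonneg y)
  filter_upwards [hr, hl] with y h1 h2
  rw [Real.dist_eq, abs_lt]
  constructor <;> linarith

end

/-! Write `q_t` for the denominator of the `t`-th convergent of `x` and `S_t` for its digit sum. The
rank `t` cylinder around `x` is an interval of the Stern-Brocot sequence of level `S_t`
(`sternBrocotAdj_convergent`), so `?` grows on it by `2 ^ (-S_t)`, while its length is at most `1 /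
q_t ^ 2`. For digits bounded by `n`, every difference quotient at `x` is bounded below by a constant
times some `q_t ^ 2 / 2 ^ S_t` (`slopeScale_le_slope`), and at convergents there is a matching upper
bound (`slope_convergent_le`). Everything thus reduces to the behaviour of `slopeScale`.

A run of ones multiplies `q_t` by about `λ_1` per digit, a pair `n, 1` by about `μ_n`. Mixing both
so that `q_t ^ 2` and `2 ^ S_t` grow at equal rates forces the mean digit to be `κ_n`.

For (i), the point is that no digits in `[1, n]` with the same length and sum do essentially worse.
The gauge `coneMin` of `(q_t, q_(t-1))` grows at each digit `a` at least by `digitWeight n a`. The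
weights are exponential in `a` and exact on the two patterns, so their product depends only on `t`
and `S_t` and beats `2 ^ (S_t / 2)` by exactly a multiple of `κ_n t - S_t` in logarithms
(`log_prod_digitWeight`). This alone gives boundedness from below. If the gauge outgrows the weights
without bound, `slopeScale` diverges. Otherwise it gains no definite factor from some point on, and
`exists_coneMin_gap` forces the digits to be eventually all ones, where `κ_n > 1` gives divergence,
or eventually `n, 1, n, 1, ...`, whose mean `(n + 1) / 2` exceeds `κ_n` and violates the hypothesis.

For (ii), alternate long runs of ones, which make `slopeScale` huge, with runs of `n, 1` continued
until the permitted sum is nearly exhausted. There `κ_n t - S_t` is about `-ψ`, and since `ψ` is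
unbounded this outweighs the constant inherited from the prefix and brings `slopeScale` below `1`
(`exists_extension`). Repeating this makes the quotients at convergents oscillate. -/

/-! ### Continuants -/

/-- The denominators of the convergents of `[0; a 0, a 1, ...]`, shifted by one:
`cfDen a (t + 1)` is the denominator of `[0; a 0, ..., a (t - 1)]`. -/
def cfDen (a : ℕ → ℕ) : ℕ → ℕ
  | 0 => 0
  | 1 => 1
  | t + 2 => a t * cfDen a (t + 1) + cfDen a t

/-- The numerators of the convergents of `[0; a 0, a 1, ...]`, shifted by one. -/
def cfNum (a : ℕ → ℕ) : ℕ → ℕ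
  | 0 => 1
  | 1 => 0
  | t + 2 => a t * cfNum a (t + 1) + cfNum a t

/-- The signed linear form `± (cfNum a t - cfDen a t * y)`. -/
noncomputable def cfErr (a : ℕ → ℕ) (y : ℝ) (t : ℕ) : ℝ :=
  (-1) ^ t * ((cfNum a t : ℝ) - (cfDen a t : ℝ) * y)

/-- The numbers in `[0, 1]` whose expansion starts with `a 0, ..., a (t - 1)`, endpoints
included. -/
def cfCylinder (a : ℕ → ℕ) (t : ℕ) : Set ℝ :=
  {y | 0 ≤ cfErr a y (t + 1) ∧ cfErr a y (t + 1) ≤ cfErr a y t}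

theorem cfDen_add_two (a : ℕ → ℕ) (t : ℕ) :
    cfDen a (t + 2) = a t * cfDen a (t + 1) + cfDen a t := rfl

theorem cfNum_add_two (a : ℕ → ℕ) (t : ℕ) :
    cfNum a (t + 2) = a t * cfNum a (t + 1) + cfNum a t := rfl

theorem cfErr_zero (a : ℕ → ℕ) (y : ℝ) : cfErr a y 0 = 1 := by simp [cfErr, cfNum, cfDen]

theorem cfErr_one (a : ℕ → ℕ) (y : ℝ) : cfErr a y 1 = y := by simp [cfErr, cfNum, cfDen]

theorem cfErr_add_two (a : ℕ → ℕ) (y : ℝ) (t : ℕ) :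
    cfErr a y (t + 2) = cfErr a y t - a t * cfErr a y (t + 1) := by
  simp only [cfErr, cfDen_add_two, cfNum_add_two, pow_succ]
  push_cast
  ring

/-- The determinant identity of consecutive convergents, expressed through the linear forms; it is
invariant under the common recursion. -/
theorem cfDen_mul_cfErr (a : ℕ → ℕ) (y : ℝ) (t : ℕ) :
    (cfDen a (t + 1) : ℝ) * cfErr a y t + cfDen a t * cfErr a y (t + 1) = 1 := by
  induction t with
  | zero => simp [cfErr_zero, cfDen]
  | succ t ih =>
    rw [cfErr_add_two, cfDen_add_two]
    push_cast
    linear_combination ih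

theorem cfErr_sub_cfErr (a : ℕ → ℕ) (x y : ℝ) (t : ℕ) :
    |cfErr a x t - cfErr a y t| = cfDen a t * |x - y| := by
  have h : cfErr a x t - cfErr a y t = (-1) ^ t * (cfDen a t * (y - x)) := by
    simp only [cfErr]; ring
  rw [h, abs_mul, abs_pow, abs_neg, abs_one, one_pow, one_mul, abs_mul, Nat.abs_cast, abs_sub_comm]

theorem continuous_cfErr (a : ℕ → ℕ) (t : ℕ) : Continuous fun y => cfErr a y t := by
  unfold cfErr
  fun_prop

theorem cfDen_mono_add {a : ℕ → ℕ} (ha : ∀ t, 1 ≤ a t) (t : ℕ) :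
    cfDen a (t + 1) + cfDen a t ≤ cfDen a (t + 2) := by
  rw [cfDen_add_two]
  have := Nat.mul_le_mul_right (cfDen a (t + 1)) (ha t)
  omega

theorem cfDen_pos {a : ℕ → ℕ} (ha : ∀ t, 1 ≤ a t) (t : ℕ) : 0 < cfDen a (t + 1) := by
  induction t with
  | zero => simp [cfDen]
  | succ t ih => exact lt_of_lt_of_le (by omega) (cfDen_mono_add ha t)

theorem cfDen_le_succ {a : ℕ → ℕ} (ha : ∀ t, 1 ≤ a t) (t : ℕ) : cfDen a t ≤ cfDen a (t + 1) := by
  cases t with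
  | zero => simp [cfDen]
  | succ t => exact le_trans (by omega) (cfDen_mono_add ha t)

theorem le_cfDen {a : ℕ → ℕ} (ha : ∀ t, 1 ≤ a t) (t : ℕ) : t ≤ cfDen a (t + 1) := by
  induction t with
  | zero => simp
  | succ t ih =>
    cases t with
    | zero => exact cfDen_pos ha 1
    | succ t =>
      have h1 : cfDen a (t + 2) + cfDen a (t + 1) ≤ cfDen a (t + 3) := cfDen_mono_add ha (t + 1)
      have h2 := cfDen_pos ha t
      change t + 1 ≤ cfDen a (t + 2) at ih
      change t + 2 ≤ cfDen a (t + 3)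
      omega

theorem cfCylinder_succ_subset {a : ℕ → ℕ} (ha : ∀ t, 1 ≤ a t) (t : ℕ) :
    cfCylinder a (t + 1) ⊆ cfCylinder a t := by
  rintro y ⟨h1, h2⟩
  rw [show t + 1 + 1 = t + 2 from rfl] at h1 h2
  have h0 : 0 ≤ cfErr a y (t + 1) := h1.trans h2
  have h1' := h1
  rw [cfErr_add_two] at h1'
  have : (1 : ℝ) ≤ a t := by exact_mod_cast ha t
  exact ⟨h0, by nlinarith⟩

theorem cfCylinder_antitone {a : ℕ → ℕ} (ha : ∀ t, 1 ≤ a t) : Antitone (cfCylinder a) :=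
  antitone_nat_of_succ_le (cfCylinder_succ_subset ha)

theorem cfErr_le_of_mem {a : ℕ → ℕ} (ha : ∀ t, 1 ≤ a t) {t : ℕ} {y : ℝ} (hy : y ∈ cfCylinder a t) :
    cfErr a y (t + 1) ≤ 1 / (cfDen a (t + 1) : ℝ) := by
  have h := cfDen_mul_cfErr a y t
  have h0 : (0 : ℝ) < cfDen a (t + 1) := by exact_mod_cast cfDen_pos ha t
  rw [le_div_iff₀ h0]
  have h1 : (0 : ℝ) ≤ cfDen a t * cfErr a y (t + 1) := mul_nonneg (by positivity) hy.1
  nlinarith [mul_le_mul_of_nonneg_left hy.2 h0.le]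

theorem abs_sub_le_of_mem_cfCylinder {a : ℕ → ℕ} (ha : ∀ t, 1 ≤ a t) {t : ℕ} {x y : ℝ}
    (hx : x ∈ cfCylinder a t)
    (hy : y ∈ cfCylinder a t) : |y - x| ≤ 1 / (cfDen a (t + 1) : ℝ) ^ 2 := by
  have h0 : (0 : ℝ) < cfDen a (t + 1) := by exact_mod_cast cfDen_pos ha t
  have h := cfErr_sub_cfErr a y x (t + 1)
  have h1 : |cfErr a y (t + 1) - cfErr a x (t + 1)| ≤ 1 / (cfDen a (t + 1) : ℝ) := by
    rw [abs_le]
    constructor <;> linarith [cfErr_le_of_mem ha hx, cfErr_le_of_mem ha hy, hx.1, hy.1]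
  rw [h, le_div_iff₀ h0] at h1
  rw [le_div_iff₀ (by positivity)]
  nlinarith

theorem convergent_cfErr {a : ℕ → ℕ} (ha : ∀ t, 1 ≤ a t) (t : ℕ) :
    cfErr a ((cfNum a (t + 1) : ℝ) / cfDen a (t + 1)) (t + 1) = 0 := by
  have h0 : (cfDen a (t + 1) : ℝ) ≠ 0 := by exact_mod_cast (cfDen_pos ha t).ne'
  rw [cfErr, mul_div_cancel₀ _ h0, sub_self, mul_zero]

theorem cfErr_pos_of_eq_zero {a : ℕ → ℕ} (ha : ∀ t, 1 ≤ a t) {t : ℕ} {y : ℝ}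
    (hy : cfErr a y (t + 1) = 0) : 0 < cfErr a y t := by
  have h := cfDen_mul_cfErr a y t
  have h0 : (0 : ℝ) < cfDen a (t + 1) := by exact_mod_cast cfDen_pos ha t
  rw [hy, mul_zero, add_zero] at h
  by_contra hc
  nlinarith

theorem convergent_mem_cfCylinder {a : ℕ → ℕ} (ha : ∀ t, 1 ≤ a t) (t : ℕ) :
    (cfNum a (t + 1) : ℝ) / cfDen a (t + 1) ∈ cfCylinder a t := by
  have h := convergent_cfErr ha t
  exact ⟨h.ge, h.trans_le (cfErr_pos_of_eq_zero ha h).le⟩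

/-- A vanishing form makes the next but one equal to the positive form before it, which the
following cylinder forbids. -/
theorem cfErr_pos_of_forall_mem {a : ℕ → ℕ} (ha : ∀ t, 1 ≤ a t) {x : ℝ}
    (hx : ∀ t, x ∈ cfCylinder a t) (t : ℕ) :
    0 < cfErr a x t := by
  cases t with
  | zero => simp [cfErr_zero]
  | succ t =>
    refine lt_of_le_of_ne (hx t).1 fun h => ?_
    have h2 : cfErr a x (t + 2) = cfErr a x t := by rw [cfErr_add_two, ← h]; ring
    have := (hx (t + 1)).2
    rw [show t + 1 + 1 = t + 2 from rfl, h2, ← h] at this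
    exact absurd (cfErr_pos_of_eq_zero ha h.symm) (not_lt.mpr this)

theorem cfErr_lt_of_forall_mem {a : ℕ → ℕ} (ha : ∀ t, 1 ≤ a t) {x : ℝ}
    (hx : ∀ t, x ∈ cfCylinder a t) (t : ℕ) :
    cfErr a x (t + 1) < cfErr a x t := by
  have h1 := cfErr_add_two a x t
  have h2 := cfErr_pos_of_forall_mem ha hx (t + 2)
  have h3 := cfErr_pos_of_forall_mem ha hx (t + 1)
  have : (1 : ℝ) ≤ a t := by exact_mod_cast ha t
  nlinarith

theorem exists_forall_mem_cfCylinder {a : ℕ → ℕ} (ha : ∀ t, 1 ≤ a t) :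
    ∃ x : ℝ, ∀ t, x ∈ cfCylinder a t := by
  have hclosed : ∀ t, IsClosed (cfCylinder a t) := fun t =>
    (isClosed_le continuous_const (continuous_cfErr a _)).inter
      (isClosed_le (continuous_cfErr a _) (continuous_cfErr a _))
  have hsub : cfCylinder a 0 ⊆ Icc 0 1 := by
    rintro y ⟨h1, h2⟩
    rw [zero_add, cfErr_one] at h1 h2
    rw [cfErr_zero] at h2
    exact ⟨h1, h2⟩
  obtain ⟨x, hx⟩ := IsCompact.nonempty_iInter_of_sequence_nonempty_isCompact_isClosed
    (cfCylinder a) (cfCylinder_succ_subset ha) (fun t => ⟨_, convergent_mem_cfCylinder ha t⟩)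
    (isCompact_Icc.of_isClosed_subset (hclosed 0) hsub) hclosed
  exact ⟨x, fun t => mem_iInter.mp hx t⟩

/-! ### Regular continued fractions -/

theorem partialQuotient_zero {v : ℝ} (hv : v ∈ Ioo (0 : ℝ) 1) :
    partialQuotient v 0 = (⌊v⁻¹⌋ : ℝ) := by
  have hf : Int.fract v = v := Int.fract_eq_self.mpr ⟨hv.1.le, hv.2⟩
  have h := GenContFract.of_s_head (v := v) (by rw [hf]; exact hv.1.ne')
  rw [partialQuotient, GenContFract.partDen_eq_s_b (show (GenContFract.of v).s.get? 0 = _ from h)]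
  simp [hf]

theorem partialQuotient_succ {v : ℝ} (hv : v ∈ Ioo (0 : ℝ) 1) (j : ℕ) :
    partialQuotient v (j + 1) = partialQuotient (Int.fract v⁻¹) j := by
  have hf : Int.fract v = v := Int.fract_eq_self.mpr ⟨hv.1.le, hv.2⟩
  -- The expansion after the integer part depends only on the fractional part; integers are separate
  -- because `of_s_head` needs a nonzero fractional part.
  have key : ∀ (w : ℝ) (k : ℕ), (GenContFract.of w).s.get? k =
      (GenContFract.of (Int.fract w)).s.get? k := by
    intro w k
    cases k with
    | succ k => rw [GenContFract.of_s_succ, GenContFract.of_s_succ, Int.fract_fract]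
    | zero =>
      by_cases h : Int.fract w = 0
      · obtain ⟨z, hz⟩ : ∃ z : ℤ, w = z := ⟨⌊w⌋, eq_of_sub_eq_zero h⟩
        rw [h, hz, GenContFract.of_s_of_int, ← Int.cast_zero, GenContFract.of_s_of_int]
      · have h1 := GenContFract.of_s_head h
        have h2 := GenContFract.of_s_head (v := Int.fract w) (by rwa [Int.fract_fract])
        rw [Int.fract_fract, ← h1] at h2
        exact h2.symm
  have h := GenContFract.of_s_succ (v := v) j
  rw [hf, key v⁻¹] at h
  unfold partialQuotient GenContFract.partDens
  rw [Stream'.Seq.map_get?, Stream'.Seq.map_get?, h]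

/-- Links Mathlib's expansion to any orbit of the Gauss map; below the orbit is `cfErr a x (t + 1) /
cfErr a x t`. -/
theorem partialQuotient_eq_of_iterates {ξ : ℕ → ℝ} {a : ℕ → ℕ} (h : ∀ t, ξ t ∈ Ioo (0 : ℝ) 1)
    (h' : ∀ t, (ξ t)⁻¹ = a t + ξ (t + 1)) (t : ℕ) : partialQuotient (ξ 0) t = a t := by
  induction t generalizing ξ a with
  | zero =>
    rw [partialQuotient_zero (h 0), h', Int.floor_natCast_add,
      Int.floor_eq_zero_iff.mpr ⟨(h 1).1.le, (h 1).2⟩]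
    simp
  | succ t ih =>
    have hf : Int.fract (ξ 0)⁻¹ = ξ 1 := by
      rw [h', Int.fract_natCast_add, Int.fract_eq_self.mpr ⟨(h _).1.le, (h _).2⟩]
    rw [partialQuotient_succ (h 0), hf]
    exact ih (ξ := fun k => ξ (k + 1)) (a := fun k => a (k + 1)) (fun k => h _) (fun k => h' _)

theorem partialQuotient_eq_of_forall_mem {a : ℕ → ℕ} (ha : ∀ t, 1 ≤ a t) {x : ℝ}
    (hx : ∀ t, x ∈ cfCylinder a t) (t : ℕ) : partialQuotient x t = a t := by
  have hpos := cfErr_pos_of_forall_mem ha hx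
  have h := partialQuotient_eq_of_iterates (ξ := fun t => cfErr a x (t + 1) / cfErr a x t) (a := a)
    (fun t => ⟨div_pos (hpos _) (hpos _), (div_lt_one (hpos _)).mpr
        (cfErr_lt_of_forall_mem ha hx t)⟩)
    (fun t => by
      have := (hpos (t + 1)).ne'
      rw [cfErr_add_two, inv_div]
      field_simp
      ring) t
  simpa [cfErr_zero, cfErr_one] using h

theorem irrational_of_forall_mem {a : ℕ → ℕ} (ha : ∀ t, 1 ≤ a t) {x : ℝ}
    (hx : ∀ t, x ∈ cfCylinder a t) : Irrational x := by
  rintro ⟨q, rfl⟩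
  obtain ⟨j, hj⟩ := (GenContFract.terminates_iff_rat (q : ℝ)).mpr ⟨q, rfl⟩
  have h := partialQuotient_eq_of_forall_mem ha hx j
  -- Past the end of a terminating expansion `partialQuotient` takes its default value `0`, whereas
  -- all digits are at least `1`.
  rw [partialQuotient, GenContFract.partDen_none_iff_s_none.mpr hj] at h
  have := ha j
  have h0 : a j = 0 := by
    rw [Option.getD_none] at h
    exact_mod_cast h.symm
  omega

theorem exists_digits {x : ℝ} (hx : Irrational x) (hx' : x ∈ Ioo (0 : ℝ) 1) :
    ∃ a : ℕ → ℕ, (∀ t, 1 ≤ a t) ∧ (∀ t, partialQuotient x t = a t) ∧ ∀ t, x ∈ cfCylinder a t := by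
  let ξ : ℕ → ℝ := fun t => Nat.rec x (fun _ z => Int.fract z⁻¹) t
  have hsucc : ∀ t, ξ (t + 1) = Int.fract (ξ t)⁻¹ := fun t => rfl
  have hirr : ∀ t, Irrational (ξ t) := by
    intro t
    induction t with
    | zero => exact hx
    | succ t ih =>
      rw [hsucc, Int.fract]
      exact (irrational_inv_iff.mpr ih).sub_intCast _
  have hI : ∀ t, ξ t ∈ Ioo (0 : ℝ) 1 := by
    intro t
    cases t with
    | zero => exact hx'
    | succ t =>
      refine ⟨lt_of_le_of_ne (Int.fract_nonneg _) (hirr (t + 1)).ne_zero.symm, Int.fract_lt_one _⟩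
  have h1 : ∀ t, 1 < (ξ t)⁻¹ := fun t => (one_lt_inv₀ (hI t).1).mpr (hI t).2
  have hrec : ∀ t, (ξ t)⁻¹ = (⌊(ξ t)⁻¹⌋₊ : ℝ) + ξ (t + 1) := by
    intro t
    rw [hsucc, natCast_floor_eq_intCast_floor (zero_le_one.trans (h1 t).le), Int.floor_add_fract]
  refine ⟨fun t => ⌊(ξ t)⁻¹⌋₊, fun t => Nat.le_floor (by simpa using (h1 t).le),
    partialQuotient_eq_of_iterates hI hrec, fun t => ?_⟩
  set a : ℕ → ℕ := fun t => ⌊(ξ t)⁻¹⌋₊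
  -- The Gauss iterates are the ratios of consecutive linear forms.
  have key : ∀ t, 0 < cfErr a x t ∧ cfErr a x (t + 1) = ξ t * cfErr a x t := by
    intro t
    induction t with
    | zero =>
      refine ⟨by simp [cfErr_zero], ?_⟩
      rw [zero_add, cfErr_one, cfErr_zero, mul_one]
      rfl
    | succ t ih =>
      obtain ⟨ih1, ih2⟩ := ih
      refine ⟨ih2 ▸ mul_pos (hI t).1 ih1, ?_⟩
      have h0 := (hI t).1.ne'
      have h := hrec t
      have h3 := mul_inv_cancel₀ h0
      rw [cfErr_add_two, ih2]
      change _ - (⌊(ξ t)⁻¹⌋₊ : ℝ) * _ = _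
      linear_combination cfErr a x t * ξ t * h - cfErr a x t * h3
  obtain ⟨k1, k2⟩ := key t
  exact ⟨(key (t + 1)).1.le, by rw [k2]; nlinarith [(hI t).2]⟩

/-! ### Cylinders are Stern-Brocot intervals -/

/-- The sum of the first `t` digits. -/
def digitSum (a : ℕ → ℕ) (t : ℕ) : ℕ := ∑ j ∈ Finset.range t, a j

theorem digitSum_succ (a : ℕ → ℕ) (t : ℕ) : digitSum a (t + 1) = digitSum a t + a t :=
  Finset.sum_range_succ _ _

/-- `u` and `v` are neighbours, in one order or the other, in the `N`-th Stern-Brocot sequence. -/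
def SternBrocotAdj (N : ℕ) (u v : ℕ × ℕ) : Prop :=
  ∃ j < 2 ^ N, (sternBrocot N j = u ∧ sternBrocot N (j + 1) = v) ∨
    (sternBrocot N j = v ∧ sternBrocot N (j + 1) = u)

theorem SternBrocotAdj.symm {N : ℕ} {u v : ℕ × ℕ} (h : SternBrocotAdj N u v) :
    SternBrocotAdj N v u := by
  obtain ⟨j, hj, h⟩ := h
  exact ⟨j, hj, h.symm⟩

theorem SternBrocotAdj.mediant {N : ℕ} {u v : ℕ × ℕ} (h : SternBrocotAdj N u v) :
    SternBrocotAdj (N + 1) u (v + u) := by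
  obtain ⟨j, hj, ⟨rfl, rfl⟩ | ⟨rfl, rfl⟩⟩ := h
  · refine ⟨2 * j, by rw [pow_succ]; omega, Or.inl ⟨sternBrocot_even _ _, ?_⟩⟩
    rw [sternBrocot_odd, add_comm]
  · refine ⟨2 * j + 1, by rw [pow_succ]; omega, Or.inr ⟨sternBrocot_odd _ _, ?_⟩⟩
    rw [show 2 * j + 1 + 1 = 2 * (j + 1) by ring, sternBrocot_even]

theorem SternBrocotAdj.mediant_iterate {N : ℕ} {u v : ℕ × ℕ} (h : SternBrocotAdj N u v) (k : ℕ) :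
    SternBrocotAdj (N + k) u (v + k • u) := by
  induction k with
  | zero => simpa using h
  | succ k ih =>
    have := ih.mediant
    rwa [add_assoc v, ← succ_nsmul, add_assoc] at this

/-- Passing from rank `t` to `t + 1` takes `a t` mediants: `a t - 1` with the current convergent
kept as an endpoint, which produce the next convergent, and one more on the side of the latter. -/
theorem sternBrocotAdj_convergent {a : ℕ → ℕ} (ha : ∀ t, 1 ≤ a t) (t : ℕ) :
    SternBrocotAdj (digitSum a t) (cfNum a (t + 1), cfDen a (t + 1))
      (cfNum a t + cfNum a (t + 1), cfDen a t + cfDen a (t + 1)) := by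
  induction t with
  | zero =>
    refine ⟨0, by simp, Or.inl ?_⟩
    simp [digitSum, sternBrocot, cfNum, cfDen]
  | succ t ih =>
    have h := (ih.mediant_iterate (a t - 1)).symm.mediant
    obtain ⟨k, hk⟩ : ∃ k, a t = k + 1 := ⟨a t - 1, by have := ha t; omega⟩
    have e1 : ((cfNum a t + cfNum a (t + 1), cfDen a t + cfDen a (t + 1)) : ℕ × ℕ) +
        (a t - 1) • (cfNum a (t + 1), cfDen a (t + 1)) = (cfNum a (t + 2), cfDen a (t + 2)) := by
      rw [cfNum_add_two, cfDen_add_two, hk]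
      ext <;> simp <;> ring
    rw [e1] at h
    have e2 : digitSum a (t + 1) = digitSum a t + (a t - 1) + 1 := by
      rw [digitSum_succ, hk]; omega
    rw [e2]
    exact h

theorem cfCylinder_eq_uIcc {a : ℕ → ℕ} (ha : ∀ t, 1 ≤ a t) (t : ℕ) :
    cfCylinder a t = uIcc ((cfNum a (t + 1) : ℝ) / cfDen a (t + 1))
      ((cfNum a t + cfNum a (t + 1) : ℝ) / (cfDen a t + cfDen a (t + 1))) := by
  have h0 : (0 : ℝ) < cfDen a (t + 1) := by exact_mod_cast cfDen_pos ha t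
  have h1 : (0 : ℝ) < cfDen a t + cfDen a (t + 1) := by positivity
  have hmem := convergent_mem_cfCylinder ha t
  rcases Nat.even_or_odd t with ht | ht
  · have key : cfCylinder a t = Icc ((cfNum a (t + 1) : ℝ) / cfDen a (t + 1))
      ((cfNum a t + cfNum a (t + 1) : ℝ) / (cfDen a t + cfDen a (t + 1))) := by
      ext y
      simp only [cfCylinder, cfErr, pow_succ, ht.neg_one_pow, mem_ofPred_eq, mem_Icc]
      rw [div_le_iff₀ h0, le_div_iff₀ h1]
      constructor <;> rintro ⟨h2, h3⟩ <;> constructor <;> linarith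
    rw [key, mem_Icc] at hmem
    rw [key, uIcc_of_le hmem.2]
  · have key : cfCylinder a t = Icc ((cfNum a t + cfNum a (t + 1) : ℝ) /
      (cfDen a t + cfDen a (t + 1))) ((cfNum a (t + 1) : ℝ) / cfDen a (t + 1)) := by
      ext y
      simp only [cfCylinder, cfErr, pow_succ, ht.neg_one_pow, mem_ofPred_eq, mem_Icc]
      rw [le_div_iff₀ h0, div_le_iff₀ h1]
      constructor <;> rintro ⟨h2, h3⟩ <;> constructor <;> linarith
    rw [key, mem_Icc] at hmem
    rw [key, uIcc_of_ge hmem.1]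

theorem exists_cfCylinder_eq_Icc {a : ℕ → ℕ} (ha : ∀ t, 1 ≤ a t) (t : ℕ) :
    ∃ j < 2 ^ digitSum a t, cfCylinder a t =
      Icc (sternBrocotFrac (digitSum a t) j) (sternBrocotFrac (digitSum a t) (j + 1)) := by
  obtain ⟨j, hj, h⟩ := sternBrocotAdj_convergent ha t
  refine ⟨j, hj, ?_⟩
  have hlt := (sternBrocotFrac_lt_succ _ _ hj).le
  rw [cfCylinder_eq_uIcc ha]
  unfold sternBrocotFrac at hlt ⊢
  rcases h with ⟨h1, h2⟩ | ⟨h1, h2⟩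
  · rw [h1, h2] at hlt ⊢
    push_cast at hlt ⊢
    rw [uIcc_of_le hlt]
  · rw [h1, h2] at hlt ⊢
    push_cast at hlt ⊢
    rw [uIcc_of_ge hlt]

theorem sternBrocotFrac_le (n j k : ℕ) (hjk : j ≤ k) (hk : k ≤ 2 ^ n) :
    sternBrocotFrac n j ≤ sternBrocotFrac n k := by
  rcases hjk.eq_or_lt with rfl | h
  · exact le_rfl
  · exact (sternBrocotFrac_lt n j k h hk).le

/-- Both points belong to the finer level `m`, where distinct elements have values of `?` at least
`1 / 2 ^ m` apart. -/
theorem add_inv_le_of_sternBrocotFrac_lt {n m i k : ℕ} (hnm : n ≤ m) (hi : i ≤ 2 ^ n)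
    (h : sternBrocotFrac n i < sternBrocotFrac m k) :
    (i : ℝ) / 2 ^ n + 1 / 2 ^ m ≤ (k : ℝ) / 2 ^ m := by
  obtain ⟨d, rfl⟩ := Nat.exists_eq_add_of_le hnm
  have hb : 2 ^ d * i ≤ 2 ^ (n + d) := by
    rw [pow_add, mul_comm]; exact Nat.mul_le_mul_right _ hi
  have hk : 2 ^ d * i + 1 ≤ k := by
    by_contra hc
    have := sternBrocotFrac_le (n + d) k (2 ^ d * i) (by omega) hb
    rw [sternBrocotFrac_refine] at this
    exact absurd h (not_lt.mpr this)
  have hk' : (2 : ℝ) ^ d * i + 1 ≤ k := by exact_mod_cast hk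
  have e : (i : ℝ) / 2 ^ n = 2 ^ d * i / 2 ^ (n + d) := by
    rw [pow_add]; field_simp
  rw [e, ← add_div]
  gcongr

theorem add_inv_le_of_lt_sternBrocotFrac {n m i k : ℕ} (hnm : n ≤ m) (hk : k ≤ 2 ^ m)
    (h : sternBrocotFrac m k < sternBrocotFrac n i) :
    (k : ℝ) / 2 ^ m + 1 / 2 ^ m ≤ (i : ℝ) / 2 ^ n := by
  obtain ⟨d, rfl⟩ := Nat.exists_eq_add_of_le hnm
  have hi : k + 1 ≤ 2 ^ d * i := by
    by_contra hc
    have := sternBrocotFrac_le (n + d) (2 ^ d * i) k (by omega) hk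
    rw [sternBrocotFrac_refine] at this
    exact absurd h (not_lt.mpr this)
  have hi' : (k : ℝ) + 1 ≤ 2 ^ d * i := by exact_mod_cast hi
  have e : (i : ℝ) / 2 ^ n = 2 ^ d * i / 2 ^ (n + d) := by
    rw [pow_add]; field_simp
  rw [e, ← add_div]
  gcongr

/-! ### Difference quotients of the question mark function -/

theorem abs_minkowskiQuestion_sub_le {a : ℕ → ℕ} (ha : ∀ t, 1 ≤ a t) {t : ℕ} {x y : ℝ}
    (hx : x ∈ cfCylinder a t) (hy : y ∈ cfCylinder a t) :
    |minkowskiQuestion y - minkowskiQuestion x| ≤ 1 / 2 ^ digitSum a t := by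
  obtain ⟨j, hj, h⟩ := exists_cfCylinder_eq_Icc ha t
  rw [h] at hx hy
  have hl := minkowskiQuestion_sternBrocotFrac _ j hj.le
  have hr := minkowskiQuestion_sternBrocotFrac _ (j + 1) hj
  push_cast at hr
  rw [add_div] at hr
  have m := minkowskiQuestion_monotone
  rw [abs_le]
  constructor <;> linarith [m hx.1, m hx.2, m hy.1, m hy.2]

/-- Two ranks are needed: a cylinder may share an endpoint with the one just above it, namely when
the digit is `1`. -/
theorem cfCylinder_subset_interior {a : ℕ → ℕ} (ha : ∀ t, 1 ≤ a t) (t : ℕ) :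
    cfCylinder a (t + 2) ⊆ interior (cfCylinder a t) := by
  have hopen : IsOpen {y | 0 < cfErr a y (t + 1) ∧ cfErr a y (t + 1) < cfErr a y t} :=
    (isOpen_lt continuous_const (continuous_cfErr a _)).inter
      (isOpen_lt (continuous_cfErr a _) (continuous_cfErr a _))
  refine Subset.trans ?_ (interior_maximal (fun y hy => ⟨hy.1.le, hy.2.le⟩) hopen)
  rintro y ⟨h1, h2⟩
  have e1 : cfErr a y (t + 3) = _ := cfErr_add_two a y (t + 1)
  have e0 := cfErr_add_two a y t
  have a1 : (1 : ℝ) ≤ a (t + 1) := by exact_mod_cast ha _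
  have a0 : (1 : ℝ) ≤ a t := by exact_mod_cast ha _
  change 0 ≤ cfErr a y (t + 3) at h1
  change cfErr a y (t + 3) ≤ cfErr a y (t + 2) at h2
  have h3 : 0 < cfErr a y (t + 2) := by
    refine lt_of_le_of_ne (h1.trans h2) fun h => ?_
    have := cfErr_pos_of_eq_zero ha (t := t + 1) h.symm
    rw [show t + 1 + 1 = t + 2 from rfl] at e1
    rw [← h] at e1 h2
    linarith
  rw [show t + 1 + 1 = t + 2 from rfl] at e1
  have h4 : 0 < cfErr a y (t + 1) := by nlinarith
  exact ⟨h4, by nlinarith⟩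

/-- Between `x` and `y` lies the gap from an endpoint of the inner cylinder to an endpoint of the
outer one; it contains a whole Stern-Brocot interval of level `digitSum a (t + 2)`. -/
theorem inv_le_abs_minkowskiQuestion_sub {a : ℕ → ℕ} (ha : ∀ t, 1 ≤ a t) {t : ℕ} {x y : ℝ}
    (hx : x ∈ cfCylinder a (t + 2)) (hy : y ∉ cfCylinder a t) :
    1 / 2 ^ digitSum a (t + 2) ≤ |minkowskiQuestion y - minkowskiQuestion x| := by
  obtain ⟨i, hi, h⟩ := exists_cfCylinder_eq_Icc ha t
  obtain ⟨j, hj, h'⟩ := exists_cfCylinder_eq_Icc ha (t + 2)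
  have hS : digitSum a t ≤ digitSum a (t + 2) :=
    Finset.sum_le_sum_of_subset (Finset.range_subset_range.mpr (by omega))
  have hsub := cfCylinder_subset_interior ha t
  rw [h, h', interior_Icc] at hsub
  rw [h'] at hx
  rw [h, mem_Icc, not_and_or, not_le, not_le] at hy
  have hlt := (sternBrocotFrac_lt_succ _ _ hj).le
  have m := minkowskiQuestion_monotone
  have hl := hsub ⟨le_rfl, hlt⟩
  have hr := hsub ⟨hlt, le_rfl⟩
  have ql := add_inv_le_of_sternBrocotFrac_lt hS hi.le hl.1
  have qr := add_inv_le_of_lt_sternBrocotFrac hS hj hr.2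
  rw [← minkowskiQuestion_sternBrocotFrac _ _ hi.le,
      ← minkowskiQuestion_sternBrocotFrac _ _ hj.le] at ql
  rw [← minkowskiQuestion_sternBrocotFrac _ _ hi, ← minkowskiQuestion_sternBrocotFrac _ _ hj] at qr
  rcases hy with hy | hy
  · rw [abs_sub_comm]
    refine le_trans ?_ (le_abs_self _)
    linarith [m hy.le, m hx.1]
  · refine le_trans ?_ (le_abs_self _)
    linarith [m hy.le, m hx.2]

theorem slope_minkowskiQuestion_eq_abs (x y : ℝ) :
    (minkowskiQuestion y - minkowskiQuestion x) / (y - x) =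
      |minkowskiQuestion y - minkowskiQuestion x| / |y - x| := by
  rw [← abs_div, abs_of_nonneg]
  rcases le_total x y with h | h
  · exact div_nonneg (sub_nonneg.mpr (minkowskiQuestion_monotone h)) (sub_nonneg.mpr h)
  · exact div_nonneg_of_nonpos (sub_nonpos.mpr (minkowskiQuestion_monotone h)) (sub_nonpos.mpr h)

/-- The order of magnitude of the difference quotients at distance about
`1 / cfDen a (t + 1) ^ 2`. -/
noncomputable def slopeScale (a : ℕ → ℕ) (t : ℕ) : ℝ := (cfDen a (t + 1) : ℝ) ^ 2 / 2 ^ digitSum a t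

theorem digitSum_add_le {a : ℕ → ℕ} {n : ℕ} (han : ∀ t, a t ≤ n) (t k : ℕ) :
    digitSum a (t + k) ≤ digitSum a t + k * n := by
  induction k with
  | zero => simp
  | succ k ih =>
    rw [← add_assoc, digitSum_succ, Nat.succ_mul]
    have := han (t + k)
    omega

theorem slopeScale_le_slope {a : ℕ → ℕ} (ha : ∀ t, 1 ≤ a t) {n : ℕ} (han : ∀ t, a t ≤ n) {x y : ℝ}
    (hx : ∀ t, x ∈ cfCylinder a t) (hxy : y ≠ x) {t : ℕ} (hy : y ∈ cfCylinder a t)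
    (hy' : y ∉ cfCylinder a (t + 1)) :
    slopeScale a t / 2 ^ (3 * n) ≤ (minkowskiQuestion y - minkowskiQuestion x) / (y - x) := by
  rw [slope_minkowskiQuestion_eq_abs]
  have h0 : (0 : ℝ) < cfDen a (t + 1) := by exact_mod_cast cfDen_pos ha t
  have h1 := inv_le_abs_minkowskiQuestion_sub ha (hx (t + 3)) hy'
  have h2 := abs_sub_le_of_mem_cfCylinder ha (hx t) hy
  -- Leaving the rank `t + 1` cylinder is seen at rank `t + 3`, three digits of size at most `n`
  -- after rank `t`.
  have h3 : (1 : ℝ) / 2 ^ (digitSum a t + 3 * n) ≤ 1 / 2 ^ digitSum a (t + 3) :=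
    one_div_le_one_div_of_le (by positivity)
      (pow_le_pow_right₀ (by norm_num) (digitSum_add_le han t 3))
  have h4 : 0 < |y - x| := abs_pos.mpr (sub_ne_zero.mpr hxy)
  rw [le_div_iff₀ h4]
  calc slopeScale a t / 2 ^ (3 * n) * |y - x|
      ≤ slopeScale a t / 2 ^ (3 * n) * (1 / (cfDen a (t + 1) : ℝ) ^ 2) := by
        unfold slopeScale
        gcongr
    _ = 1 / 2 ^ (digitSum a t + 3 * n) := by
        unfold slopeScale
        rw [pow_add]
        field_simp
    _ ≤ _ := h3.trans h1

theorem convergent_ne {a : ℕ → ℕ} (ha : ∀ t, 1 ≤ a t) {x : ℝ}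
    (hx : ∀ t, x ∈ cfCylinder a t) (t : ℕ) : (cfNum a (t + 1) : ℝ) / cfDen a (t + 1) ≠ x := by
  intro h
  have := convergent_cfErr ha t
  rw [h] at this
  exact (cfErr_pos_of_forall_mem ha hx _).ne' this

theorem convergent_notMem {a : ℕ → ℕ} (ha : ∀ t, 1 ≤ a t) (t : ℕ) :
    (cfNum a (t + 1) : ℝ) / cfDen a (t + 1) ∉ cfCylinder a (t + 1) := by
  rintro ⟨-, h⟩
  have h1 := convergent_cfErr ha t
  rw [show t + 1 + 1 = t + 2 from rfl, cfErr_add_two, h1] at h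
  linarith [cfErr_pos_of_eq_zero ha h1]

/-- With bounded digits `x` is badly approximable: its distance to the convergent is at least `1 /
((n + 2) * q_t ^ 2)`. -/
theorem slope_convergent_le {a : ℕ → ℕ} (ha : ∀ t, 1 ≤ a t) {n : ℕ} (han : ∀ t, a t ≤ n) {x : ℝ}
    (hx : ∀ t, x ∈ cfCylinder a t) (t : ℕ) :
    (minkowskiQuestion ((cfNum a (t + 1) : ℝ) / cfDen a (t + 1)) - minkowskiQuestion x) /
      ((cfNum a (t + 1) : ℝ) / cfDen a (t + 1) - x) ≤ (n + 2) * slopeScale a t := by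
  rw [slope_minkowskiQuestion_eq_abs]
  set y := (cfNum a (t + 1) : ℝ) / cfDen a (t + 1) with hy
  have h0 : (0 : ℝ) < cfDen a (t + 1) := by exact_mod_cast cfDen_pos ha t
  have h1 := abs_minkowskiQuestion_sub_le ha (hx t) (convergent_mem_cfCylinder ha t)
  have h4 : 0 < |y - x| := abs_pos.mpr (sub_ne_zero.mpr (convergent_ne ha hx t))
  have h5 := cfErr_sub_cfErr a y x (t + 1)
  have hE := cfErr_pos_of_forall_mem ha hx (t + 1)
  rw [convergent_cfErr ha, zero_sub, abs_neg, abs_of_pos hE] at h5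
  have h6 := cfDen_mul_cfErr a x (t + 1)
  rw [show t + 1 + 1 = t + 2 from rfl, cfDen_add_two] at h6
  push_cast at h6
  have h7 : (cfDen a t : ℝ) ≤ cfDen a (t + 1) := by exact_mod_cast cfDen_le_succ ha t
  have h8 := cfErr_lt_of_forall_mem ha hx (t + 1)
  have h9 : (a t : ℝ) ≤ n := by exact_mod_cast han t
  have h10 : 1 ≤ (n + 2) * (cfDen a (t + 1) : ℝ) * cfErr a x (t + 1) := by
    rw [← h6]
    have : (a t * cfDen a (t + 1) + cfDen a t : ℝ) ≤ (n + 1) * cfDen a (t + 1) := by nlinarith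
    nlinarith
  rw [div_le_iff₀ h4]
  refine h1.trans ?_
  rw [h5] at h10
  unfold slopeScale
  calc (1 : ℝ) / 2 ^ digitSum a t
      ≤ ((n + 2) * (cfDen a (t + 1) : ℝ) * (cfDen a (t + 1) * |y - x|)) / 2 ^ digitSum a t := by
        gcongr
    _ = _ := by ring

theorem exists_notMem_cfCylinder {a : ℕ → ℕ} (ha : ∀ t, 1 ≤ a t) {x y : ℝ}
    (hx : ∀ t, x ∈ cfCylinder a t) (hxy : y ≠ x) : ∃ t, y ∉ cfCylinder a t := by
  by_contra! h
  have h4 : 0 < |y - x| := abs_pos.mpr (sub_ne_zero.mpr hxy)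
  obtain ⟨t, ht⟩ := exists_nat_gt (1 / |y - x|)
  have h1 := abs_sub_le_of_mem_cfCylinder ha (hx t) (h t)
  have h0 : (0 : ℝ) < cfDen a (t + 1) := by exact_mod_cast cfDen_pos ha t
  have h2 : (t : ℝ) ≤ cfDen a (t + 1) := by exact_mod_cast le_cfDen ha t
  have h3 : (1 : ℝ) ≤ cfDen a (t + 1) := by exact_mod_cast cfDen_pos ha t
  rw [le_div_iff₀ (by positivity)] at h1
  rw [div_lt_iff₀ h4] at ht
  nlinarith [mul_le_mul_of_nonneg_right h2 h4.le,
    mul_le_mul_of_nonneg_right h3 (mul_nonneg h4.le h0.le)]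

theorem hasExtendedDerivAt_top_of_slopeScale {a : ℕ → ℕ} (ha : ∀ t, 1 ≤ a t) {n : ℕ}
    (han : ∀ t, a t ≤ n) {x : ℝ} (hx : ∀ t, x ∈ cfCylinder a t)
    (h : Tendsto (slopeScale a) atTop atTop) : HasExtendedDerivAt minkowskiQuestion ⊤ x := by
  rw [HasExtendedDerivAt, EReal.tendsto_coe_nhds_top_iff, tendsto_atTop]
  intro M
  obtain ⟨T, hT⟩ := eventually_atTop.mp (h.eventually_ge_atTop (M * 2 ^ (3 * n)))
  have hnhds : cfCylinder a T ∈ 𝓝 x :=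
    mem_interior_iff_mem_nhds.mp (cfCylinder_subset_interior ha T (hx _))
  filter_upwards [mem_nhdsWithin_of_mem_nhds hnhds, self_mem_nhdsWithin] with y hy hyx
  classical
  have hex := exists_notMem_cfCylinder ha hx hyx
  have hlt : T < Nat.find hex := by
    by_contra hc
    exact Nat.find_spec hex (cfCylinder_antitone ha (not_lt.mp hc) hy)
  obtain ⟨t, ht⟩ : ∃ t, Nat.find hex = t + 1 := ⟨Nat.find hex - 1, by omega⟩
  have h1 : y ∉ cfCylinder a (t + 1) := ht ▸ Nat.find_spec hex
  have h2 : y ∈ cfCylinder a t := by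
    by_contra hc
    have := Nat.find_min' hex hc
    omega
  refine le_trans ?_ (slopeScale_le_slope ha han hx hyx h2 h1)
  rw [le_div_iff₀ (by positivity)]
  exact hT t (by omega)

/-- Quotients along the convergents suffice: a bounded subsequence makes the limit smaller than a
real number, an unbounded one contradicts this. -/
theorem not_hasExtendedDerivAt_of_slopeScale {a : ℕ → ℕ} (ha : ∀ t, 1 ≤ a t) {n : ℕ}
    (han : ∀ t, a t ≤ n) {x : ℝ} (hx : ∀ t, x ∈ cfCylinder a t)
    (hlarge : ∀ K, ∃ᶠ t in atTop, K ≤ slopeScale a t)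
    (hsmall : ∃ K, ∃ᶠ t in atTop, slopeScale a t ≤ K) :
    ¬ ∃ L : EReal, HasExtendedDerivAt minkowskiQuestion L x := by
  rintro ⟨L, hL⟩
  obtain ⟨K, hK⟩ := hsmall
  set u : ℕ → ℝ := fun t => (cfNum a (t + 1) : ℝ) / cfDen a (t + 1)
  have hu : Tendsto u atTop (𝓝[≠] x) := by
    refine tendsto_nhdsWithin_iff.mpr ⟨?_, Eventually.of_forall fun t => convergent_ne ha hx t⟩
    rw [tendsto_iff_dist_tendsto_zero]
    refine squeeze_zero' (Eventually.of_forall fun t => dist_nonneg) ?_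
      tendsto_one_div_atTop_nhds_zero_nat
    filter_upwards [eventually_ge_atTop 1] with t ht
    rw [Real.dist_eq]
    refine (abs_sub_le_of_mem_cfCylinder ha (hx t) (convergent_mem_cfCylinder ha t)).trans ?_
    have h1 : (1 : ℝ) ≤ t := by exact_mod_cast ht
    have h2 : (t : ℝ) ≤ cfDen a (t + 1) := by exact_mod_cast le_cfDen ha t
    refine one_div_le_one_div_of_le (by linarith) ?_
    nlinarith
  have hlim := hL.comp hu
  have hle : L ≤ (((n + 2) * K : ℝ) : EReal) := by
    refine isClosed_Iic.mem_of_frequently_of_tendsto ?_ hlim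
    refine hK.mono fun t ht => ?_
    refine EReal.coe_le_coe_iff.mpr ((slope_convergent_le ha han hx t).trans ?_)
    gcongr
  have hlt : L < (((n + 2) * K + 1 : ℝ) : EReal) :=
    hle.trans_lt (EReal.coe_lt_coe_iff.mpr (lt_add_one _))
  obtain ⟨t, h1, h2⟩ := ((hlarge (((n + 2) * K + 1) * 2 ^ (3 * n))).and_eventually
    (hlim.eventually (gt_mem_nhds hlt))).exists
  have h3 := slopeScale_le_slope ha han hx (convergent_ne ha hx t) (convergent_mem_cfCylinder ha t)
    (convergent_notMem ha t)
  rw [← le_div_iff₀ (by positivity)] at h1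
  exact absurd (EReal.coe_lt_coe_iff.mp h2) (not_lt.mpr (h1.trans h3))

/-! ### The constants -/

theorem lambdaConst_one_sq : lambdaConst 1 ^ 2 = lambdaConst 1 + 1 := by
  have h := Real.sq_sqrt (show (0 : ℝ) ≤ ((1 : ℕ) : ℝ) ^ 2 + 4 by positivity)
  unfold lambdaConst
  push_cast at h ⊢
  linear_combination h / 4

theorem lambdaConst_one_bounds : 1.618 < lambdaConst 1 ∧ lambdaConst 1 < 1.6181 := by
  have h := lambdaConst_one_sq
  have h0 : 0 ≤ lambdaConst 1 := by unfold lambdaConst; positivity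
  constructor <;> nlinarith

theorem lambdaConst_one_pos : 0 < lambdaConst 1 := by linarith [lambdaConst_one_bounds.1]

theorem muConst_sq (n : ℕ) : muConst n ^ 2 = (n + 2) * muConst n - 1 := by
  have h := Real.sq_sqrt (show (0 : ℝ) ≤ (n : ℝ) ^ 2 + 4 * (n : ℝ) by positivity)
  unfold muConst
  linear_combination h / 4

theorem muConst_lower {n : ℕ} (hn : 1 ≤ n) : (n : ℝ) + 1 < muConst n := by
  have hn' : (1 : ℝ) ≤ n := by exact_mod_cast hn
  have : (n : ℝ) < √((n : ℝ) ^ 2 + 4 * n) := Real.lt_sqrt_of_sq_lt (by linarith)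
  unfold muConst
  linarith

theorem muConst_pos {n : ℕ} (hn : 1 ≤ n) : 0 < muConst n := by
  have := muConst_lower hn
  have hn0 : (0 : ℝ) ≤ n := n.cast_nonneg
  linarith

theorem muConst_upper {n : ℕ} (hn : 1 ≤ n) : muConst n < n + 2 := by
  have h0 := muConst_pos hn
  have := muConst_sq n
  nlinarith

/-- A pair `n, 1` lowers `slopeScale`: it multiplies `q_t ^ 2` by about `μ_n ^ 2` and `2 ^ S_t` by
`2 ^ (n + 1)`. This fails for `n = 4`, where `μ_4 ^ 2 ≈ 33.97 > 32`. -/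
theorem muConst_sq_lt {n : ℕ} (hn : 5 ≤ n) : muConst n ^ 2 < 2 ^ (n + 1) := by
  have h0 := muConst_pos (n := n) (by omega)
  have h1 := muConst_upper (n := n) (by omega)
  have h2 : (n + 2) ^ 2 ≤ 2 ^ (n + 1) := by
    clear h0 h1
    induction n, hn using Nat.le_induction with
    | base => norm_num
    | succ k hk ih =>
      rw [pow_succ 2]
      nlinarith
  have h3 : ((n : ℝ) + 2) ^ 2 ≤ 2 ^ (n + 1) := by exact_mod_cast h2
  nlinarith

/-- The denominator of `kappaConst`. -/
noncomputable def kappaDen (n : ℕ) : ℝ :=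
  ((n : ℝ) - 1) * Real.log (√2) - Real.log (muConst n) + 2 * Real.log (lambdaConst 1)

theorem log_muConst_lt {n : ℕ} (hn : 5 ≤ n) :
    Real.log (muConst n) < ((n : ℝ) + 1) * Real.log (√2) := by
  have h := Real.log_lt_log (pow_pos (muConst_pos (n := n) (by omega)) 2) (muConst_sq_lt hn)
  rw [Real.log_pow, Real.log_pow] at h
  rw [Real.log_sqrt (by norm_num)]
  push_cast at h
  linarith

theorem log_sqrt_two_lt : Real.log (√2) < Real.log (lambdaConst 1) := by
  refine Real.log_lt_log (by positivity) ?_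
  rw [Real.sqrt_lt' lambdaConst_one_pos]
  nlinarith [lambdaConst_one_bounds.1]

theorem kappaDen_pos {n : ℕ} (hn : 5 ≤ n) : 0 < kappaDen n := by
  unfold kappaDen
  linarith [log_muConst_lt hn, log_sqrt_two_lt]

theorem kappaConst_mul_kappaDen {n : ℕ} (hn : 5 ≤ n) : kappaConst n * kappaDen n =
    ((n : ℝ) + 1) * Real.log (lambdaConst 1) - Real.log (muConst n) :=
  div_mul_cancel₀ _ (kappaDen_pos hn).ne'

theorem one_lt_kappaConst {n : ℕ} (hn : 5 ≤ n) : 1 < kappaConst n := by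
  have h := kappaDen_pos hn
  have hn' : (5 : ℝ) ≤ n := by exact_mod_cast hn
  have h1 := kappaConst_mul_kappaDen hn
  refine lt_of_mul_lt_mul_right ?_ h.le
  rw [h1, one_mul, kappaDen]
  nlinarith [log_sqrt_two_lt]

/-- The mean digit of `n, 1, n, 1, ...` is supercritical. -/
theorem two_mul_kappaConst_lt {n : ℕ} (hn : 5 ≤ n) : 2 * kappaConst n < n + 1 := by
  have h := kappaDen_pos hn
  have hn' : (5 : ℝ) ≤ n := by exact_mod_cast hn
  have h1 := kappaConst_mul_kappaDen hn
  refine lt_of_mul_lt_mul_right ?_ h.le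
  rw [mul_assoc, h1, kappaDen]
  nlinarith [log_muConst_lt hn]

/-! ### A gauge on pairs of consecutive continuants

`coneMin` is the minimum of the growth of the continuants along the two shifts of the purely
periodic continuation `n, 1, n, 1, ...`. -/

/-- The growth functional of the continuation `n, 1, n, 1, ...`. -/
noncomputable def growthFromMax (n : ℕ) (q p : ℝ) : ℝ := (muConst n - 1) * q + p

/-- The growth functional of the continuation `1, n, 1, n, ...`. -/
noncomputable def growthFromOne (n : ℕ) (q p : ℝ) : ℝ :=
  (muConst n * q + (muConst n - 1) * p) / lambdaConst 1

/-- The minimum of the two growth functionals. -/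
noncomputable def coneMin (n : ℕ) (q p : ℝ) : ℝ := min (growthFromMax n q p) (growthFromOne n q p)

/-- The growth factor per digit `a` of the gauge. -/
noncomputable def digitWeight (n a : ℕ) : ℝ :=
  lambdaConst 1 * (muConst n / lambdaConst 1 ^ 2) ^ (((a : ℝ) - 1) / ((n : ℝ) - 1))

theorem growthFromMax_one (n : ℕ) (q p : ℝ) :
    growthFromMax n (q + p) q = lambdaConst 1 * growthFromOne n q p := by
  have := lambdaConst_one_pos.ne'
  unfold growthFromMax growthFromOne
  field_simp
  ring

theorem growthFromOne_one (n : ℕ) (q p : ℝ) : growthFromOne n (q + p) q =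
    growthFromOne n q p + growthFromMax n q p / lambdaConst 1 := by
  unfold growthFromMax growthFromOne
  rw [← add_div]
  ring

theorem growthFromOne_max (n : ℕ) (q p : ℝ) : growthFromOne n (n * q + p) q =
    muConst n / lambdaConst 1 * growthFromMax n q p := by
  have := lambdaConst_one_pos.ne'
  have h := muConst_sq n
  unfold growthFromMax growthFromOne
  field_simp
  linear_combination -q * h

/-- Repeating `n` instead of following it by `1` does not hurt growth; the slack comes from `μ_n < n
+ 2 ≤ λ_1 n`. -/
theorem growthFromMax_max {n : ℕ} (hn : 5 ≤ n) {q p : ℝ} (hq : 0 ≤ q) (hp : 0 ≤ p) :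
    muConst n / lambdaConst 1 * growthFromMax n q p ≤ growthFromMax n (n * q + p) q := by
  obtain ⟨h1, h2⟩ := lambdaConst_one_bounds
  have h3 := muConst_lower (n := n) (by omega)
  have h4 := muConst_upper (n := n) (by omega)
  have hn' : (5 : ℝ) ≤ n := by exact_mod_cast hn
  rw [div_mul_eq_mul_div, div_le_iff₀ lambdaConst_one_pos]
  unfold growthFromMax
  have e1 : muConst n * (muConst n - 1) ≤ lambdaConst 1 * ((muConst n - 1) * n + 1) := by
    have : muConst n ≤ lambdaConst 1 * n := by nlinarith
    nlinarith
  have e2 : muConst n ≤ lambdaConst 1 * (muConst n - 1) := by nlinarith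
  nlinarith [mul_le_mul_of_nonneg_right e1 hq, mul_le_mul_of_nonneg_right e2 hp]

theorem growthFromMax_pos {n : ℕ} (hn : 5 ≤ n) {q p : ℝ} (hq : 0 < q) (hp : 0 ≤ p) :
    0 < growthFromMax n q p := by
  have h3 := muConst_lower (n := n) (by omega)
  have hn' : (5 : ℝ) ≤ n := by exact_mod_cast hn
  have : 0 < (muConst n - 1) * q := mul_pos (by linarith) hq
  unfold growthFromMax
  linarith

theorem growthFromOne_pos {n : ℕ} (hn : 5 ≤ n) {q p : ℝ} (hq : 0 < q) (hp : 0 ≤ p) :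
    0 < growthFromOne n q p := by
  have h3 := muConst_lower (n := n) (by omega)
  have hn' : (5 : ℝ) ≤ n := by exact_mod_cast hn
  have h1 : 0 < muConst n * q := mul_pos (by linarith) hq
  have h2 : 0 ≤ (muConst n - 1) * p := mul_nonneg (by linarith) hp
  exact div_pos (by linarith) lambdaConst_one_pos

theorem coneMin_pos {n : ℕ} (hn : 5 ≤ n) {q p : ℝ} (hq : 0 < q) (hp : 0 ≤ p) :
    0 < coneMin n q p :=
  lt_min (growthFromMax_pos hn hq hp) (growthFromOne_pos hn hq hp)

/-- The two functionals cross for a ratio `p / q` between `1 / 2` and `5 / 6`. In the pattern `n, 1,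
n, 1, ...` with `n ≥ 5` the ratio is at most `1 / 5` after `n` and at least `5 / 6` after the `1`,
so these thresholds tell the two phases apart. -/
theorem growthFromOne_gap {n : ℕ} (hn : 5 ≤ n) {q p : ℝ} (hq : 0 < q) (hpq : 5 * q ≤ 6 * p) :
    51 / 50 * growthFromMax n q p ≤ growthFromOne n q p := by
  obtain ⟨h1, h2⟩ := lambdaConst_one_bounds
  have h3 := muConst_lower (n := n) (by omega)
  have hn' : (5 : ℝ) ≤ n := by exact_mod_cast hn
  unfold growthFromMax growthFromOne
  rw [le_div_iff₀ lambdaConst_one_pos]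
  have e1 : 51 / 50 * ((muConst n - 1) * q + p) * lambdaConst 1 ≤
      51 / 50 * ((muConst n - 1) * q + p) * 1.6181 := by
    refine mul_le_mul_of_nonneg_left h2.le ?_
    have : 0 ≤ (muConst n - 1) * q := mul_nonneg (by linarith) hq.le
    linarith
  refine e1.trans ?_
  nlinarith [mul_nonneg (sub_nonneg.mpr hpq) (sub_nonneg.mpr h3.le),
    mul_nonneg hq.le (sub_nonneg.mpr h3.le), mul_nonneg (sub_nonneg.mpr hpq) (sub_nonneg.mpr hn'),
    mul_nonneg hq.le (sub_nonneg.mpr hn')]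

theorem growthFromMax_gap {n : ℕ} (hn : 5 ≤ n) {q p : ℝ} (hq : 0 < q) (hp : 0 ≤ p)
    (hpq : 2 * p ≤ q) : 51 / 50 * growthFromOne n q p ≤ growthFromMax n q p := by
  obtain ⟨h1, h2⟩ := lambdaConst_one_bounds
  have h3 := muConst_lower (n := n) (by omega)
  have hn' : (5 : ℝ) ≤ n := by exact_mod_cast hn
  unfold growthFromMax growthFromOne
  rw [mul_div_assoc', div_le_iff₀ lambdaConst_one_pos]
  have e1 : ((muConst n - 1) * q + p) * 1.618 ≤ ((muConst n - 1) * q + p) * lambdaConst 1 := by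
    refine mul_le_mul_of_nonneg_left h1.le ?_
    have : 0 ≤ (muConst n - 1) * q := mul_nonneg (by linarith) hq.le
    linarith
  refine le_trans ?_ e1
  nlinarith [mul_nonneg (sub_nonneg.mpr hpq) (sub_nonneg.mpr h3.le),
    mul_nonneg hq.le (sub_nonneg.mpr h3.le), mul_nonneg (sub_nonneg.mpr hpq) (sub_nonneg.mpr hn'),
    mul_nonneg hq.le (sub_nonneg.mpr hn')]

theorem coneMin_one (n : ℕ) (q p : ℝ) :
    lambdaConst 1 * coneMin n q p ≤ coneMin n (q + p) q := by
  have h0 := lambdaConst_one_pos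
  have hC : coneMin n q p ≤ growthFromOne n q p := min_le_right _ _
  have hB : coneMin n q p ≤ growthFromMax n q p := min_le_left _ _
  refine le_min ?_ ?_
  · rw [growthFromMax_one]
    exact mul_le_mul_of_nonneg_left hC h0.le
  · rw [growthFromOne_one]
    -- This is `λ_1 = 1 + 1 / λ_1`.
    have e : lambdaConst 1 * coneMin n q p = coneMin n q p + coneMin n q p / lambdaConst 1 := by
      field_simp
      linear_combination coneMin n q p * lambdaConst_one_sq
    rw [e]
    gcongr

theorem coneMin_one_gap {n : ℕ} (hn : 5 ≤ n) {q p : ℝ} (hq : 0 < q) (hpq : 5 * q ≤ 6 * p) :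
    101 / 100 * (lambdaConst 1 * coneMin n q p) ≤ coneMin n (q + p) q := by
  have h0 := lambdaConst_one_pos
  obtain ⟨h1, h2⟩ := lambdaConst_one_bounds
  have hB : coneMin n q p ≤ growthFromMax n q p := min_le_left _ _
  have hBpos : 0 < growthFromMax n q p := growthFromMax_pos hn hq (by linarith)
  have hgap := growthFromOne_gap hn hq hpq
  have h3 : 101 / 100 * (lambdaConst 1 * coneMin n q p) ≤
      101 / 100 * (lambdaConst 1 * growthFromMax n q p) := by gcongr
  refine h3.trans (le_min ?_ ?_)
  · rw [growthFromMax_one]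
    nlinarith [mul_le_mul_of_nonneg_left hgap h0.le, mul_pos h0 hBpos]
  · rw [growthFromOne_one]
    have e : lambdaConst 1 * growthFromMax n q p =
        growthFromMax n q p + growthFromMax n q p / lambdaConst 1 := by
      field_simp
      linear_combination lambdaConst_one_sq
    have e' : growthFromMax n q p / lambdaConst 1 ≤ growthFromMax n q p :=
      div_le_self hBpos.le (by linarith)
    rw [e]
    linarith

theorem le_coneMin_max {n : ℕ} (hn : 5 ≤ n) {q p : ℝ} (hq : 0 ≤ q) (hp : 0 ≤ p) :
    muConst n / lambdaConst 1 * growthFromMax n q p ≤ coneMin n (n * q + p) q :=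
  le_min (growthFromMax_max hn hq hp) (growthFromOne_max n q p).ge

theorem coneMin_max {n : ℕ} (hn : 5 ≤ n) {q p : ℝ} (hq : 0 ≤ q) (hp : 0 ≤ p) :
    muConst n / lambdaConst 1 * coneMin n q p ≤ coneMin n (n * q + p) q :=
  (mul_le_mul_of_nonneg_left (min_le_left _ _)
    (div_pos (muConst_pos (by omega)) lambdaConst_one_pos).le).trans (le_coneMin_max hn hq hp)

theorem coneMin_max_gap {n : ℕ} (hn : 5 ≤ n) {q p : ℝ} (hq : 0 < q) (hp : 0 ≤ p)
    (hpq : 2 * p ≤ q) :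
    101 / 100 * (muConst n / lambdaConst 1 * coneMin n q p) ≤ coneMin n (n * q + p) q := by
  refine le_trans ?_ (le_coneMin_max hn hq.le hp)
  have h := div_pos (muConst_pos (n := n) (by omega)) lambdaConst_one_pos
  have hgap := growthFromMax_gap hn hq hp hpq
  have hC : coneMin n q p ≤ growthFromOne n q p := min_le_right _ _
  have hpos := growthFromOne_pos hn hq hp
  rw [mul_left_comm]
  refine mul_le_mul_of_nonneg_left ?_ h.le
  linarith

/-- The linear interpolation of the growth factors of the digits `1` and `n`. -/
noncomputable def interpWeight (n a : ℕ) : ℝ :=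
  lambdaConst 1 * (1 + ((a : ℝ) - 1) / ((n : ℝ) - 1) * (muConst n / lambdaConst 1 ^ 2 - 1))

/-- Both functionals at `(a * q + p, q)` are affine in `a`, so the bounds for the digits `1` and `n`
interpolate. -/
theorem interpWeight_mul_coneMin_le {n : ℕ} (hn : 5 ≤ n) {a : ℕ} (ha : 1 ≤ a) (han : a ≤ n)
    {q p : ℝ} (hq : 0 ≤ q) (hp : 0 ≤ p) :
    interpWeight n a * coneMin n q p ≤ coneMin n (a * q + p) q := by
  have hn' : (5 : ℝ) ≤ n := by exact_mod_cast hn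
  have ha' : (1 : ℝ) ≤ a := by exact_mod_cast ha
  have han' : (a : ℝ) ≤ n := by exact_mod_cast han
  have h0 := lambdaConst_one_pos
  set s : ℝ := ((a : ℝ) - 1) / ((n : ℝ) - 1) with hs
  have hs0 : 0 ≤ s := div_nonneg (by linarith) (by linarith)
  have hs1 : s ≤ 1 := div_le_one_of_le₀ (by linarith) (by linarith)
  have hsa : (a : ℝ) = (1 - s) * 1 + s * n := by
    have : s * ((n : ℝ) - 1) = a - 1 := div_mul_cancel₀ _ (by linarith)
    linarith
  have e1 := coneMin_one n q p
  have e2 := coneMin_max hn hq hp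
  have e : interpWeight n a * coneMin n q p = (1 - s) * (lambdaConst 1 * coneMin n q p) +
      s * (muConst n / lambdaConst 1 * coneMin n q p) := by
    rw [interpWeight, ← hs]
    field_simp
    ring
  rw [e]
  have hB : growthFromMax n (a * q + p) q = (1 - s) * growthFromMax n (q + p) q +
      s * growthFromMax n (n * q + p) q := by
    unfold growthFromMax; rw [hsa]; ring
  have hC : growthFromOne n (a * q + p) q = (1 - s) * growthFromOne n (q + p) q +
      s * growthFromOne n (n * q + p) q := by
    unfold growthFromOne; rw [hsa]; ring
  have hs' : 0 ≤ 1 - s := by linarith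
  refine le_min ?_ ?_
  · rw [hB]
    gcongr
    · exact e1.trans (min_le_left _ _)
    · exact e2.trans (min_le_left _ _)
  · rw [hC]
    gcongr
    · exact e1.trans (min_le_right _ _)
    · exact e2.trans (min_le_right _ _)

theorem one_lt_muConst_div {n : ℕ} (hn : 5 ≤ n) : 1 < muConst n / lambdaConst 1 ^ 2 := by
  obtain ⟨h1, h2⟩ := lambdaConst_one_bounds
  have h3 := muConst_lower (n := n) (by omega)
  have hn' : (5 : ℝ) ≤ n := by exact_mod_cast hn
  rw [lambdaConst_one_sq, one_lt_div (by linarith)]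
  linarith

theorem digitWeight_pos {n : ℕ} (hn : 5 ≤ n) (a : ℕ) : 0 < digitWeight n a :=
  mul_pos lambdaConst_one_pos (Real.rpow_pos_of_pos (by linarith [one_lt_muConst_div hn]) _)

/-- The exponential lies below its chord on `[1, n]`, by Bernoulli's inequality. -/
theorem digitWeight_le_interpWeight {n : ℕ} (hn : 5 ≤ n) {a : ℕ} (ha : 1 ≤ a) (han : a ≤ n) :
    digitWeight n a ≤ interpWeight n a := by
  have hn' : (5 : ℝ) ≤ n := by exact_mod_cast hn
  have ha' : (1 : ℝ) ≤ a := by exact_mod_cast ha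
  have han' : (a : ℝ) ≤ n := by exact_mod_cast han
  have h := one_lt_muConst_div hn
  refine mul_le_mul_of_nonneg_left ?_ lambdaConst_one_pos.le
  have := rpow_one_add_le_one_add_mul_self (s := muConst n / lambdaConst 1 ^ 2 - 1)
    (by linarith) (p := ((a : ℝ) - 1) / ((n : ℝ) - 1)) (div_nonneg (by linarith) (by linarith))
    (div_le_one_of_le₀ (by linarith) (by linarith))
  rwa [add_sub_cancel] at this

theorem digitWeight_lt_interpWeight {n : ℕ} (hn : 5 ≤ n) {a : ℕ} (ha : 1 < a) (han : a < n) :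
    digitWeight n a < interpWeight n a := by
  have hn' : (5 : ℝ) ≤ n := by exact_mod_cast hn
  have ha' : (1 : ℝ) < a := by exact_mod_cast ha
  have han' : (a : ℝ) < n := by exact_mod_cast han
  have h := one_lt_muConst_div hn
  refine mul_lt_mul_of_pos_left ?_ lambdaConst_one_pos
  have := rpow_one_add_lt_one_add_mul_self (s := muConst n / lambdaConst 1 ^ 2 - 1)
    (by linarith) (by linarith) (p := ((a : ℝ) - 1) / ((n : ℝ) - 1))
    (div_pos (by linarith) (by linarith)) ((div_lt_one (by linarith)).mpr (by linarith))
  rwa [add_sub_cancel] at this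

theorem digitWeight_one (n : ℕ) : digitWeight n 1 = lambdaConst 1 := by simp [digitWeight]

theorem digitWeight_self {n : ℕ} (hn : 5 ≤ n) : digitWeight n n = muConst n / lambdaConst 1 := by
  have hn' : (5 : ℝ) ≤ n := by exact_mod_cast hn
  have := lambdaConst_one_pos.ne'
  rw [digitWeight, div_self (by linarith), Real.rpow_one]
  field_simp

theorem digitWeight_mul_coneMin_le {n : ℕ} (hn : 5 ≤ n) {a : ℕ} (ha : 1 ≤ a) (han : a ≤ n)
    {q p : ℝ} (hq : 0 < q) (hp : 0 ≤ p) :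
    digitWeight n a * coneMin n q p ≤ coneMin n (a * q + p) q :=
  (mul_le_mul_of_nonneg_right (digitWeight_le_interpWeight hn ha han)
    (coneMin_pos hn hq hp).le).trans (interpWeight_mul_coneMin_le hn ha han hq.le hp)

/-- Unless the digits follow one of the two patterns `1, 1, ...` and `n, 1, n, 1, ...`, the gauge
grows by a definite factor more than the weights. -/
theorem exists_coneMin_gap {n : ℕ} (hn : 5 ≤ n) : ∃ δ : ℝ, 1 < δ ∧ ∀ a : ℕ, 1 ≤ a → a ≤ n →
    ∀ q p : ℝ, 0 < q → 0 ≤ p → δ * (digitWeight n a * coneMin n q p) ≤ coneMin n (a * q + p) q ∨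
      (a = 1 ∧ 6 * p < 5 * q) ∨ (a = n ∧ q < 2 * p) := by
  -- Only finitely many digits lie strictly between `1` and `n`, so one `δ` serves all the strict
  -- chord inequalities.
  have hev : ∀ᶠ δ : ℝ in 𝓝[>] 1, ∀ a ∈ Finset.Ioo 1 n, δ * digitWeight n a < interpWeight n a := by
    rw [Filter.eventually_all_finset]
    intro a ha
    rw [Finset.mem_Ioo] at ha
    refine eventually_nhdsWithin_of_eventually_nhds ?_
    have hc : Continuous fun δ : ℝ => δ * digitWeight n a := by fun_prop
    exact hc.continuousAt.eventually_lt continuousAt_const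
      (by rw [one_mul]; exact digitWeight_lt_interpWeight hn ha.1 ha.2)
  have hev2 : ∀ᶠ δ : ℝ in 𝓝[>] 1, δ < 101 / 100 :=
    eventually_nhdsWithin_of_eventually_nhds (gt_mem_nhds (by norm_num))
  obtain ⟨δ, ⟨h1, h2⟩, h3⟩ := ((hev.and hev2).and self_mem_nhdsWithin).exists
  refine ⟨δ, h3, fun a ha han q p hq hp => ?_⟩
  have hpos := coneMin_pos hn hq hp
  have hw := mul_pos (digitWeight_pos hn a) hpos
  rcases ha.eq_or_lt with rfl | ha1
  · by_cases hc : 6 * p < 5 * q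
    · exact Or.inr (Or.inl ⟨rfl, hc⟩)
    · left
      have := coneMin_one_gap hn hq (not_lt.mp hc)
      rw [digitWeight_one] at hw ⊢
      rw [Nat.cast_one, one_mul]
      nlinarith
  · rcases han.eq_or_lt with rfl | ha2
    · by_cases hc : q < 2 * p
      · exact Or.inr (Or.inr ⟨rfl, hc⟩)
      · left
        have := coneMin_max_gap hn hq hp (not_lt.mp hc)
        rw [digitWeight_self hn] at hw ⊢
        nlinarith
    · left
      refine le_trans ?_ (interpWeight_mul_coneMin_le hn ha han hq.le hp)
      rw [← mul_assoc]
      exact mul_le_mul_of_nonneg_right (h1 a (Finset.mem_Ioo.mpr ⟨ha1, ha2⟩)).le hpos.le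

/-! ### Growth of the continuants -/

/-- The gauge of the `t`-th pair of continuants relative to the product of the weights. -/
noncomputable def relGauge (n : ℕ) (a : ℕ → ℕ) (t : ℕ) : ℝ :=
  coneMin n (cfDen a (t + 1)) (cfDen a t) / ∏ j ∈ Finset.range t, digitWeight n (a j)

theorem prod_digitWeight_pos {n : ℕ} (hn : 5 ≤ n) (a : ℕ → ℕ) (t : ℕ) :
    0 < ∏ j ∈ Finset.range t, digitWeight n (a j) :=
  Finset.prod_pos fun _ _ => digitWeight_pos hn _

theorem coneMin_cfDen_pos {n : ℕ} (hn : 5 ≤ n) {a : ℕ → ℕ} (ha : ∀ t, 1 ≤ a t) (t : ℕ) :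
    0 < coneMin n (cfDen a (t + 1)) (cfDen a t) :=
  coneMin_pos hn (by exact_mod_cast cfDen_pos ha t) (Nat.cast_nonneg _)

theorem relGauge_pos {n : ℕ} (hn : 5 ≤ n) {a : ℕ → ℕ} (ha : ∀ t, 1 ≤ a t) (t : ℕ) :
    0 < relGauge n a t :=
  div_pos (coneMin_cfDen_pos hn ha t) (prod_digitWeight_pos hn a t)

theorem relGauge_monotone {n : ℕ} (hn : 5 ≤ n) {a : ℕ → ℕ} (ha : ∀ t, 1 ≤ a t)
    (han : ∀ t, a t ≤ n) : Monotone (relGauge n a) := by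
  refine monotone_nat_of_le_succ fun t => ?_
  have h := digitWeight_mul_coneMin_le hn (ha t) (han t) (q := cfDen a (t + 1)) (p := cfDen a t)
    (by exact_mod_cast cfDen_pos ha t) (Nat.cast_nonneg _)
  have hw := prod_digitWeight_pos hn a t
  have hd := digitWeight_pos hn (a t)
  unfold relGauge
  rw [Finset.prod_range_succ, div_le_div_iff₀ hw (mul_pos hw hd), cfDen_add_two]
  push_cast
  nlinarith [mul_le_mul_of_nonneg_right h hw.le]

theorem relGauge_zero (n : ℕ) (a : ℕ → ℕ) : relGauge n a 0 = coneMin n 1 0 := by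
  simp [relGauge, cfDen]

theorem log_digitWeight {n : ℕ} (hn : 5 ≤ n) (a : ℕ) : Real.log (digitWeight n a) =
    Real.log (lambdaConst 1) + ((a : ℝ) - 1) / ((n : ℝ) - 1) *
      (Real.log (muConst n) - 2 * Real.log (lambdaConst 1)) := by
  have h0 := lambdaConst_one_pos
  have h1 := one_lt_muConst_div hn
  have h2 := muConst_pos (n := n) (by omega)
  rw [digitWeight, Real.log_mul h0.ne' (Real.rpow_pos_of_pos (by linarith) _).ne',
    Real.log_rpow (by linarith), Real.log_div h2.ne' (by positivity), Real.log_pow]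
  push_cast
  ring

/-- The logarithm of a weight is affine in the digit; `kappaConst` is the mean digit at which the
weights and `√2 ^ S_t` balance. -/
theorem log_prod_digitWeight {n : ℕ} (hn : 5 ≤ n) (a : ℕ → ℕ) (t : ℕ) :
    Real.log (∏ j ∈ Finset.range t, digitWeight n (a j)) - digitSum a t * Real.log (√2) =
      kappaDen n / ((n : ℝ) - 1) * (kappaConst n * t - digitSum a t) := by
  have hn' : (5 : ℝ) ≤ n := by exact_mod_cast hn
  have hn1 : (n : ℝ) - 1 ≠ 0 := by linarith
  have hk := kappaConst_mul_kappaDen hn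
  induction t with
  | zero => simp [digitSum]
  | succ t ih =>
    rw [Finset.prod_range_succ, Real.log_mul (prod_digitWeight_pos hn a t).ne'
      (digitWeight_pos hn _).ne', log_digitWeight hn, digitSum_succ]
    have e : kappaDen n / ((n : ℝ) - 1) * (kappaConst n * ((t + 1 : ℕ) : ℝ) -
        ((digitSum a t + a t : ℕ) : ℝ)) = kappaDen n / ((n : ℝ) - 1) *
        (kappaConst n * t - digitSum a t) +
        (kappaConst n * kappaDen n - kappaDen n * a t) / ((n : ℝ) - 1) := by
      push_cast
      ring
    rw [e, ← ih, hk, kappaDen]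
    push_cast
    field_simp
    ring

theorem log_slopeScale {a : ℕ → ℕ} (ha : ∀ t, 1 ≤ a t) (t : ℕ) : Real.log (slopeScale a t) =
    2 * (Real.log (cfDen a (t + 1)) - digitSum a t * Real.log (√2)) := by
  have h0 : (0 : ℝ) < cfDen a (t + 1) := by exact_mod_cast cfDen_pos ha t
  rw [slopeScale, Real.log_div (by positivity) (by positivity), Real.log_pow, Real.log_pow,
    Real.log_sqrt (by norm_num)]
  push_cast
  ring

theorem slopeScale_pos {a : ℕ → ℕ} (ha : ∀ t, 1 ≤ a t) (t : ℕ) : 0 < slopeScale a t := by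
  have h0 : (0 : ℝ) < cfDen a (t + 1) := by exact_mod_cast cfDen_pos ha t
  unfold slopeScale
  positivity

theorem le_log_slopeScale {n : ℕ} (hn : 5 ≤ n) {a : ℕ → ℕ} (ha : ∀ t, 1 ≤ a t) (t : ℕ) :
    2 * (Real.log (relGauge n a t) - Real.log (muConst n) +
      kappaDen n / ((n : ℝ) - 1) * (kappaConst n * t - digitSum a t)) ≤
      Real.log (slopeScale a t) := by
  have h0 : (0 : ℝ) < cfDen a (t + 1) := by exact_mod_cast cfDen_pos ha t
  have hm := muConst_pos (n := n) (by omega)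
  have hG := coneMin_cfDen_pos hn ha t
  have h1 : coneMin n (cfDen a (t + 1)) (cfDen a t) ≤ muConst n * cfDen a (t + 1) := by
    refine (min_le_left _ _).trans ?_
    have : (cfDen a t : ℝ) ≤ cfDen a (t + 1) := by exact_mod_cast cfDen_le_succ ha t
    unfold growthFromMax
    linarith
  have h2 := Real.log_le_log hG h1
  rw [Real.log_mul hm.ne' h0.ne'] at h2
  rw [log_slopeScale ha, ← log_prod_digitWeight hn, relGauge,
    Real.log_div hG.ne' (prod_digitWeight_pos hn a t).ne']
  linarith

theorem tendsto_slopeScale_of_log {a : ℕ → ℕ} (ha : ∀ t, 1 ≤ a t)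
    (h : Tendsto (fun t => Real.log (slopeScale a t)) atTop atTop) :
    Tendsto (slopeScale a) atTop atTop :=
  (Real.tendsto_exp_atTop.comp h).congr fun t => Real.exp_log (slopeScale_pos ha t)

theorem digitSum_add_of_eq_one {a : ℕ → ℕ} {m k : ℕ} (h : ∀ i < k, a (m + i) = 1) :
    digitSum a (m + k) = digitSum a m + k := by
  induction k with
  | zero => rfl
  | succ k ih =>
    rw [← add_assoc, digitSum_succ, ih fun i hi => h i (by omega), h k (by omega)]
    ring

theorem digitSum_add_of_alternating {a : ℕ → ℕ} {n m k : ℕ}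
    (h : ∀ i < k, a (m + 2 * i) = n ∧ a (m + 2 * i + 1) = 1) :
    digitSum a (m + 2 * k) = digitSum a m + k * (n + 1) := by
  induction k with
  | zero => simp
  | succ k ih =>
    rw [show m + 2 * (k + 1) = m + 2 * k + 1 + 1 by ring, digitSum_succ, digitSum_succ,
      ih fun i hi => h i (by omega), (h k (by omega)).1, (h k (by omega)).2]
    ring

/-- The monotone `relGauge` either diverges, which suffices, or converges; in the latter case the
digits are eventually rigid. -/
theorem tendsto_slopeScale {n : ℕ} (hn : 5 ≤ n) {a : ℕ → ℕ} (ha : ∀ t, 1 ≤ a t)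
    (han : ∀ t, a t ≤ n) {C : ℝ} (hC : ∀ t, 1 ≤ t → (digitSum a t : ℝ) ≤ kappaConst n * t + C) :
    Tendsto (slopeScale a) atTop atTop := by
  have hn' : (5 : ℝ) ≤ n := by exact_mod_cast hn
  have hd := kappaDen_pos hn
  have hk1 := one_lt_kappaConst hn
  have hc : 0 < kappaDen n / ((n : ℝ) - 1) := div_pos hd (by linarith)
  have hmono := relGauge_monotone hn ha han
  apply tendsto_slopeScale_of_log ha
  rcases tendsto_atTop_of_monotone hmono with hlim | ⟨l, hlim⟩
  · refine tendsto_atTop_mono' _ ?_ (((tendsto_atTop_add_const_right _ (-Real.log (muConst n) +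
      kappaDen n / ((n : ℝ) - 1) * (-C)) (Real.tendsto_log_atTop.comp hlim))).const_mul_atTop
      (zero_lt_two (α := ℝ)))
    filter_upwards [eventually_ge_atTop 1] with t ht
    refine le_trans ?_ (le_log_slopeScale hn ha t)
    have := mul_le_mul_of_nonneg_left (show -C ≤ kappaConst n * t - digitSum a t by
      linarith [hC t ht]) hc.le
    simp only [Function.comp_apply]
    linarith
  · obtain ⟨δ, hδ, hgap⟩ := exists_coneMin_gap hn
    have hl : 0 < l := (relGauge_pos hn ha 0).trans_le (hmono.ge_of_tendsto hlim 0)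
    -- A positive limit makes successive ratios tend to `1`, so the gain `δ` is eventually never
    -- realised.
    have hev : ∀ᶠ t in atTop, relGauge n a (t + 1) < δ * relGauge n a t :=
      (hlim.comp (tendsto_add_atTop_nat 1)).eventually_lt (hlim.const_mul δ) (by nlinarith)
    obtain ⟨N, hN⟩ := eventually_atTop.mp hev
    have hpat : ∀ t, N ≤ t → (a t = 1 ∧ 6 * cfDen a t < 5 * cfDen a (t + 1)) ∨
        (a t = n ∧ cfDen a (t + 1) < 2 * cfDen a t) := by
      intro t ht
      have h1 := hN t ht
      have hw := prod_digitWeight_pos hn a t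
      have hd := digitWeight_pos hn (a t)
      have h2 : ¬ δ * (digitWeight n (a t) * coneMin n (cfDen a (t + 1)) (cfDen a t)) ≤
          coneMin n (a t * cfDen a (t + 1) + cfDen a t) (cfDen a (t + 1)) := by
        rw [not_le]
        unfold relGauge at h1
        rw [Finset.prod_range_succ, mul_div_assoc', div_lt_div_iff₀ (mul_pos hw hd) hw,
          cfDen_add_two] at h1
        push_cast at h1
        refine lt_of_mul_lt_mul_right (h1.trans_eq ?_) hw.le
        ring
      have h3 := (hgap (a t) (ha t) (han t) (cfDen a (t + 1)) (cfDen a t)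
        (by exact_mod_cast cfDen_pos ha t) (Nat.cast_nonneg _)).resolve_left h2
      exact_mod_cast h3
    by_cases hone : ∀ t, N ≤ t → a t = 1
    · have hlin : Tendsto (fun t : ℕ => 2 * (Real.log (relGauge n a 0) - Real.log (muConst n) +
          kappaDen n / ((n : ℝ) - 1) * ((kappaConst n - 1) * (t : ℝ) + -(digitSum a N : ℝ))))
          atTop atTop :=
        (tendsto_atTop_add_const_left _ _ ((tendsto_atTop_add_const_right _ _
          (tendsto_natCast_atTop_atTop.const_mul_atTop (by linarith))).const_mul_atTop
            hc)).const_mul_atTop zero_lt_two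
      refine tendsto_atTop_mono' _ ?_ hlin
      filter_upwards [eventually_ge_atTop N] with t ht
      refine le_trans ?_ (le_log_slopeScale hn ha t)
      obtain ⟨k, rfl⟩ := Nat.exists_eq_add_of_le ht
      have h1 := digitSum_add_of_eq_one (a := a) (m := N) (k := k) fun i _ => hone _ (by omega)
      have h2 := Real.log_le_log (relGauge_pos hn ha 0) (hmono (Nat.zero_le (N + k)))
      rw [h1]
      push_cast
      have hN0 : (0 : ℝ) ≤ N := N.cast_nonneg
      gcongr
      linarith
    · exfalso
      push Not at hone
      obtain ⟨T, hT, hT1⟩ := hone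
      have hfirst : a T = n := by
        rcases hpat T hT with h | h
        · exact absurd h.1 hT1
        · exact h.1
      -- After `n ≥ 5` the ratio `p / q` is at most `1 / 5`, which rules out another `n`; after the
      -- following `1` it is at least `5 / 6`, which rules out another `1`.
      have hstep : ∀ t, N ≤ t → a t = n → a (t + 1) = 1 ∧ a (t + 2) = n := by
        intro t ht htn
        have hp := cfDen_pos ha t
        have e1 := cfDen_add_two a t
        have e2 : cfDen a (t + 3) = a (t + 1) * cfDen a (t + 2) + cfDen a (t + 1) :=
          cfDen_add_two a (t + 1)
        rw [htn] at e1
        have h5 : 5 * cfDen a (t + 1) ≤ cfDen a (t + 2) := by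
          have := Nat.mul_le_mul_right (cfDen a (t + 1)) hn
          omega
        have h1 : a (t + 1) = 1 := by
          rcases hpat (t + 1) (by omega) with h | h
          · exact h.1
          · have : cfDen a (t + 2) < 2 * cfDen a (t + 1) := h.2
            omega
        refine ⟨h1, ?_⟩
        rcases hpat (t + 2) (by omega) with h | h
        · have : 6 * cfDen a (t + 2) < 5 * cfDen a (t + 3) := h.2
          rw [h1] at e2
          omega
        · exact h.1
      have hall : ∀ k, a (T + 2 * k) = n := by
        intro k
        induction k with
        | zero => exact hfirst
        | succ k ih => exact (hstep _ (by omega) ih).2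
      have h2 := two_mul_kappaConst_lt hn
      obtain ⟨k, hk⟩ := exists_nat_gt ((kappaConst n * T + C - digitSum a T) /
        ((n : ℝ) + 1 - 2 * kappaConst n))
      rw [div_lt_iff₀ (by linarith)] at hk
      have h3 := digitSum_add_of_alternating (a := a) (n := n) (m := T) (k := k + 1)
        fun i _ => ⟨hall i, (hstep _ (by omega) (hall i)).1⟩
      have h4 := hC (T + 2 * (k + 1)) (by omega)
      rw [h3] at h4
      push_cast at h4
      nlinarith

/-! ### Prefixes -/

theorem digitSum_congr {a b : ℕ → ℕ} {t : ℕ} (h : ∀ i < t, a i = b i) :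
    digitSum a t = digitSum b t :=
  Finset.sum_congr rfl fun i hi => h i (Finset.mem_range.mp hi)

theorem cfDen_congr {a b : ℕ → ℕ} {t : ℕ} (h : ∀ i < t, a i = b i) :
    cfDen a (t + 1) = cfDen b (t + 1) := by
  induction t using Nat.twoStepInduction with
  | zero => rfl
  | one =>
    rw [cfDen_add_two, cfDen_add_two, h 0 (by omega)]
    rfl
  | more t ih1 ih2 =>
    rw [cfDen_add_two a (t + 1), cfDen_add_two b (t + 1), h (t + 1) (by omega),
      ih1 fun i hi => h i (by omega), ih2 fun i hi => h i (by omega)]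

theorem slopeScale_congr {a b : ℕ → ℕ} {t : ℕ} (h : ∀ i < t, a i = b i) :
    slopeScale a t = slopeScale b t := by
  rw [slopeScale, slopeScale, cfDen_congr h, digitSum_congr h]

/-! ### Upper bounds for continuants -/

theorem cfDen_le_of_eq_one {a : ℕ → ℕ} (ha : ∀ t, 1 ≤ a t) {m k : ℕ} (h : ∀ i < k, a (m + i) = 1) :
    (cfDen a (m + k) : ℝ) ≤ cfDen a (m + 1) * lambdaConst 1 ^ k ∧
      (cfDen a (m + k + 1) : ℝ) ≤ cfDen a (m + 1) * lambdaConst 1 ^ (k + 1) := by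
  have h1 := lambdaConst_one_bounds.1
  have h0 : (0 : ℝ) < cfDen a (m + 1) := by exact_mod_cast cfDen_pos ha m
  induction k with
  | zero =>
    have : (cfDen a m : ℝ) ≤ cfDen a (m + 1) := by exact_mod_cast cfDen_le_succ ha m
    refine ⟨by simpa using this, ?_⟩
    rw [add_zero, zero_add, pow_one]
    nlinarith
  | succ k ih =>
    obtain ⟨ih1, ih2⟩ := ih fun i hi => h i (by omega)
    refine ⟨ih2, ?_⟩
    rw [show m + (k + 1) + 1 = m + k + 2 by ring, cfDen_add_two, h k (by omega),
      show lambdaConst 1 ^ (k + 1 + 1) = lambdaConst 1 ^ (k + 1) + lambdaConst 1 ^ k by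
        rw [pow_succ, pow_succ, mul_assoc, ← sq, lambdaConst_one_sq]; ring]
    push_cast
    linarith

/-- `growthFromMax` is an eigenfunctional, with eigenvalue `μ_n`, of the step along `n, 1`. -/
theorem growthFromMax_cfDen {a : ℕ → ℕ} {n m k : ℕ}
    (h : ∀ i < k, a (m + 2 * i) = n ∧ a (m + 2 * i + 1) = 1) :
    growthFromMax n (cfDen a (m + 2 * k + 1)) (cfDen a (m + 2 * k)) =
      muConst n ^ k * growthFromMax n (cfDen a (m + 1)) (cfDen a m) := by
  induction k with
  | zero => simp
  | succ k ih =>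
    have h0 := lambdaConst_one_pos.ne'
    obtain ⟨h1, h2⟩ := h k (by omega)
    have e1 : cfDen a (m + 2 * k + 3) = _ := cfDen_add_two a (m + 2 * k + 1)
    rw [h2, one_mul] at e1
    rw [show m + 2 * (k + 1) + 1 = m + 2 * k + 3 by ring,
      show m + 2 * (k + 1) = m + 2 * k + 2 by ring, e1]
    push_cast
    rw [growthFromMax_one, cfDen_add_two, h1]
    push_cast
    rw [growthFromOne_max, ih fun i hi => h i (by omega)]
    field_simp
    ring

/-- The additive constant depends only on the prefix and not on `A` or `B`; the construction rests
on this uniformity. -/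
theorem log_cfDen_le {n : ℕ} (hn : 5 ≤ n) {a : ℕ → ℕ} (ha : ∀ t, 1 ≤ a t) {m A B : ℕ}
    (h1 : ∀ i < A, a (m + i) = 1)
    (h2 : ∀ i < B, a (m + A + 2 * i) = n ∧ a (m + A + 2 * i + 1) = 1) :
    Real.log (cfDen a (m + A + 2 * B + 1)) ≤ B * Real.log (muConst n) +
      A * Real.log (lambdaConst 1) + Real.log (muConst n * (cfDen a (m + 1) * lambdaConst 1)) := by
  have hl := lambdaConst_one_pos
  have hm := muConst_lower (n := n) (by omega)
  have hn' : (5 : ℝ) ≤ n := by exact_mod_cast hn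
  have hm0 : 0 < muConst n := by linarith
  have h0 : (0 : ℝ) < cfDen a (m + 1) := by exact_mod_cast cfDen_pos ha m
  have hd : (0 : ℝ) < cfDen a (m + A + 2 * B + 1) := by exact_mod_cast cfDen_pos ha _
  have hd' : (0 : ℝ) ≤ cfDen a (m + A + 2 * B) := Nat.cast_nonneg _
  have e1 := growthFromMax_cfDen h2
  have e2 := (cfDen_le_of_eq_one ha h1).2
  have e3 : (cfDen a (m + A) : ℝ) ≤ cfDen a (m + A + 1) := by exact_mod_cast cfDen_le_succ ha _
  have e4 : growthFromMax n (cfDen a (m + A + 1)) (cfDen a (m + A)) ≤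
      muConst n * (cfDen a (m + 1) * lambdaConst 1 ^ (A + 1)) := by
    refine le_trans ?_ (mul_le_mul_of_nonneg_left e2 hm0.le)
    unfold growthFromMax
    linarith
  have e5 : (cfDen a (m + A + 2 * B + 1) : ℝ) ≤
      muConst n ^ B * (lambdaConst 1 ^ A * (muConst n * (cfDen a (m + 1) * lambdaConst 1))) := by
    calc (cfDen a (m + A + 2 * B + 1) : ℝ)
        ≤ growthFromMax n (cfDen a (m + A + 2 * B + 1)) (cfDen a (m + A + 2 * B)) := by
          unfold growthFromMax
          nlinarith
      _ ≤ muConst n ^ B * (muConst n * (cfDen a (m + 1) * lambdaConst 1 ^ (A + 1))) := by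
          rw [e1]
          gcongr
      _ = _ := by ring
  refine (Real.log_le_log hd e5).trans_eq ?_
  rw [Real.log_mul (by positivity) (by positivity), Real.log_mul (by positivity) (by positivity),
    Real.log_pow, Real.log_pow]
  ring

/-! ### The construction -/

/-- Continue the first `m` digits of `f` by `A` ones and then `n, 1, n, 1, ...`. -/
def extendDigits (n : ℕ) (f : ℕ → ℕ) (m A i : ℕ) : ℕ :=
  if i < m then f i else if i < m + A then 1 else if Even (i - (m + A)) then n else 1

theorem extendDigits_of_lt (n : ℕ) (f : ℕ → ℕ) {m A i : ℕ} (h : i < m) :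
    extendDigits n f m A i = f i := if_pos h

theorem extendDigits_one (n : ℕ) (f : ℕ → ℕ) {m A i : ℕ} (h : i < A) :
    extendDigits n f m A (m + i) = 1 := by
  rw [extendDigits, if_neg (by omega), if_pos (by omega)]

theorem extendDigits_alternating (n : ℕ) (f : ℕ → ℕ) (m A i : ℕ) :
    extendDigits n f m A (m + A + 2 * i) = n ∧ extendDigits n f m A (m + A + 2 * i + 1) = 1 := by
  constructor
  · rw [extendDigits, if_neg (by omega), if_neg (by omega), Nat.add_sub_cancel_left,
      if_pos (even_two_mul i)]
  · rw [extendDigits, if_neg (by omega), if_neg (by omega), add_assoc (m + A),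
      Nat.add_sub_cancel_left, if_neg (by simp)]

/-- The first `m` digits obey the bound on the digit sums. -/
def SumBounded (n : ℕ) (ψ : ℕ → ℝ) (f : ℕ → ℕ) (m : ℕ) : Prop :=
  ∀ t, 1 ≤ t → t ≤ m → (digitSum f t : ℝ) ≤ kappaConst n * t + ψ t

/-- Digits `1` only relax the bound since `κ_n > 1`, so the positions just after each `n` are
decisive; `hB` is the bound there, with `ψ` frozen at `m + A`. -/
theorem sumBounded_extendDigits {n : ℕ} (hn : 5 ≤ n) {ψ : ℕ → ℝ} (hψ : Monotone ψ) {f : ℕ → ℕ}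
    {m A B : ℕ} (hm : 1 ≤ m) (hf : SumBounded n ψ f m)
    (hB : ∀ b < B, (b : ℝ) * (n + 1 - 2 * kappaConst n) ≤ kappaConst n * ((m + A : ℕ) + 1) +
      ψ (m + A) - n - digitSum (extendDigits n f m A) (m + A)) :
    SumBounded n ψ (extendDigits n f m A) (m + A + 2 * B) := by
  have hk1 := one_lt_kappaConst hn
  set g := extendDigits n f m A with hg
  have hS1 : ∀ i ≤ A, digitSum g (m + i) = digitSum f m + i := fun i hi => by
    rw [digitSum_add_of_eq_one fun j hj => extendDigits_one n f (by omega),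
      digitSum_congr fun j hj => extendDigits_of_lt n f hj]
  have hS2 : ∀ b, digitSum g (m + A + 2 * b) = digitSum g (m + A) + b * (n + 1) := fun b =>
    digitSum_add_of_alternating fun j _ => extendDigits_alternating n f m A j
  have hfirst : ∀ i ≤ A, (digitSum g (m + i) : ℝ) ≤ kappaConst n * (m + i : ℕ) + ψ (m + i) := by
    intro i hi
    rw [hS1 i hi]
    have h1 := hf m hm le_rfl
    have h2 := hψ (Nat.le_add_right m i)
    have h3 : (0 : ℝ) ≤ i := i.cast_nonneg
    push_cast
    nlinarith
  have hodd : ∀ b < B, (digitSum g (m + A + 2 * b + 1) : ℝ) ≤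
      kappaConst n * (m + A + 2 * b + 1 : ℕ) + ψ (m + A + 2 * b + 1) := by
    intro b hb
    rw [digitSum_succ, hS2, show g (m + A + 2 * b) = n from
      (extendDigits_alternating n f m A b).1]
    have h1 := hB b hb
    have h2 := hψ (show m + A ≤ m + A + 2 * b + 1 by omega)
    push_cast at h1 ⊢
    linarith
  intro t ht1 ht2
  rcases le_total t m with h | h
  · rw [digitSum_congr fun j hj => extendDigits_of_lt n f (show j < m by omega)]
    exact hf t ht1 h
  rcases le_total t (m + A) with h' | h'
  · obtain ⟨i, rfl⟩ := Nat.exists_eq_add_of_le h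
    exact hfirst i (by omega)
  obtain ⟨i, rfl⟩ := Nat.exists_eq_add_of_le h'
  obtain ⟨b, rfl | rfl⟩ : ∃ b, i = 2 * b ∨ i = 2 * b + 1 := ⟨i / 2, by omega⟩
  · cases b with
    | zero => exact hfirst A le_rfl
    | succ b =>
      have h1 := hodd b (by omega)
      have h2 := hψ (show m + A + 2 * b + 1 ≤ m + A + 2 * b + 1 + 1 by omega)
      rw [show m + A + 2 * (b + 1) = m + A + 2 * b + 1 + 1 by ring, digitSum_succ,
        show g (m + A + 2 * b + 1) = 1 from (extendDigits_alternating n f m A b).2]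
      push_cast at h1 ⊢
      linarith
  · exact hodd b (by omega)

theorem exists_extension {n : ℕ} (hn : 5 ≤ n) {ψ : ℕ → ℝ} (hψ : Monotone ψ)
    (hψ' : Tendsto ψ atTop atTop) {f : ℕ → ℕ} {m : ℕ} (hm : 1 ≤ m)
    (hf1 : ∀ i, 1 ≤ f i) (hfn : ∀ i, f i ≤ n) (hf : SumBounded n ψ f m) (K : ℝ) :
    ∃ (g : ℕ → ℕ) (l : ℕ), m < l ∧ (∀ i < m, g i = f i) ∧ (∀ i, 1 ≤ g i) ∧ (∀ i, g i ≤ n) ∧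
      SumBounded n ψ g l ∧ (∃ t, m ≤ t ∧ t ≤ l ∧ K ≤ slopeScale g t) ∧ slopeScale g l ≤ 1 := by
  have hn' : (5 : ℝ) ≤ n := by exact_mod_cast hn
  have hk1 := one_lt_kappaConst hn
  have hk2 := two_mul_kappaConst_lt hn
  have hD := kappaDen_pos hn
  have hkD := kappaConst_mul_kappaDen hn
  have hc : 0 < kappaDen n / ((n : ℝ) - 1) := div_pos hD (by linarith)
  -- The prefix terms left over in `key` below; they are fixed before `A` is chosen.
  set c₁ : ℝ := ((n : ℝ) - 1) *
      Real.log (muConst n * (cfDen f (m + 1) * lambdaConst 1)) -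
      m * ((n : ℝ) - 1) * Real.log (lambdaConst 1) -
      (digitSum f m - m) * (Real.log (muConst n) - 2 * Real.log (lambdaConst 1)) with hc₁
  have hψA : Tendsto (fun A : ℕ => ψ (m + A)) atTop atTop :=
    hψ'.comp (tendsto_atTop_mono (fun A => Nat.le_add_left A m) tendsto_id)
  have hlin : Tendsto (fun A : ℕ => (kappaConst n - 1) * (A : ℝ)) atTop atTop :=
    tendsto_natCast_atTop_atTop.const_mul_atTop (by linarith)
  have hbig : Tendsto (fun A : ℕ => 2 * (Real.log (coneMin n 1 0) - Real.log (muConst n) +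
      kappaDen n / ((n : ℝ) - 1) * ((kappaConst n - 1) * (A : ℝ) +
        (kappaConst n * m - digitSum f m)))) atTop atTop :=
    (tendsto_atTop_add_const_left _ _ ((tendsto_atTop_add_const_right _ _ hlin).const_mul_atTop
      hc)).const_mul_atTop zero_lt_two
  -- `hA1` lets `ψ` absorb `c₁`, `hA2` leaves room for at least one pair `n, 1`, and `hA3` makes
  -- `slopeScale` large after the ones; `max K 1` keeps the logarithm meaningful.
  obtain ⟨A, ⟨⟨hA1, hA2⟩, hA3⟩, hA4⟩ := (((hψA.eventually_ge_atTop (n + c₁ / kappaDen n)).and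
    (hlin.eventually_ge_atTop (n : ℝ))).and (hbig.eventually_ge_atTop (Real.log (max K 1)))).and
    (eventually_ge_atTop 1) |>.exists
  set g := extendDigits n f m A with hg
  have hg1 : ∀ i, 1 ≤ g i := fun i => by
    rw [hg, extendDigits]
    split_ifs
    · exact hf1 i
    · exact le_rfl
    · omega
    · exact le_rfl
  have hgn : ∀ i, g i ≤ n := fun i => by
    rw [hg, extendDigits]
    split_ifs
    · exact hfn i
    · omega
    · exact le_rfl
    · omega
  have hST : digitSum g (m + A) = digitSum f m + A := by
    rw [digitSum_add_of_eq_one fun j hj => extendDigits_one n f hj,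
      digitSum_congr fun j hj => extendDigits_of_lt n f hj]
  have hE : 0 < (n : ℝ) + 1 - 2 * kappaConst n := by linarith
  set num : ℝ := kappaConst n * ((m + A : ℕ) + 1) + ψ (m + A) - n - digitSum g (m + A) with hnum
  have hnum0 : 0 ≤ num := by
    rw [hnum, hST]
    have h1 := hf m hm le_rfl
    have h2 := hψ (Nat.le_add_right m A)
    push_cast
    nlinarith
  -- The greatest number of pairs allowed by `hB`: after them `κ_n t - S_t` is below `n - ψ (m +
  -- A)`.
  set B : ℕ := ⌊num / ((n : ℝ) + 1 - 2 * kappaConst n)⌋₊ + 1 with hB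
  have hB1 : ∀ b < B, (b : ℝ) * (n + 1 - 2 * kappaConst n) ≤ num := by
    intro b hb
    rw [← le_div_iff₀ hE]
    exact (Nat.le_floor_iff (div_nonneg hnum0 hE.le)).mp (by omega)
  have hB2 : num < (B : ℝ) * (n + 1 - 2 * kappaConst n) := by
    rw [← div_lt_iff₀ hE, hB]
    push_cast
    exact Nat.lt_floor_add_one _
  have hS2 : digitSum g (m + A + 2 * B) = digitSum g (m + A) + B * (n + 1) :=
    digitSum_add_of_alternating fun j _ => extendDigits_alternating n f m A j
  refine ⟨g, m + A + 2 * B, by omega, fun i hi => extendDigits_of_lt n f hi, hg1, hgn,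
    sumBounded_extendDigits hn hψ hm hf hB1, ⟨m + A, by omega, by omega, ?_⟩, ?_⟩
  · refine (le_max_left K 1).trans ?_
    rw [← Real.log_le_log_iff (by positivity) (slopeScale_pos hg1 _)]
    refine hA3.trans (le_trans ?_ (le_log_slopeScale hn hg1 _))
    have h1 := Real.log_le_log (relGauge_pos hn hg1 0)
      (relGauge_monotone hn hg1 hgn (Nat.zero_le (m + A)))
    rw [relGauge_zero] at h1
    rw [hST]
    push_cast
    gcongr
    exact le_of_eq (by ring)
  · rw [← Real.log_nonpos_iff (slopeScale_pos hg1 _).le, log_slopeScale hg1]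
    have h1 := log_cfDen_le hn hg1 (m := m) (A := A) (B := B)
      (fun i hi => extendDigits_one n f hi) (fun i _ => extendDigits_alternating n f m A i)
    rw [cfDen_congr (b := f) (t := m) fun i hi => extendDigits_of_lt n f hi] at h1
    rw [← le_sub_iff_add_le', div_le_iff₀ hD] at hA1
    rw [hS2, hST]
    rw [hST] at hnum
    push_cast at hnum ⊢
    have hn1 : 0 < (n : ℝ) - 1 := by linarith
    suffices h : ((n : ℝ) - 1) * (B * Real.log (muConst n) + A * Real.log (lambdaConst 1) +
        Real.log (muConst n * (cfDen f (m + 1) * lambdaConst 1)) -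
        (digitSum f m + A + B * (n + 1)) * Real.log (√2)) ≤ 0 by
      have := nonpos_of_mul_nonpos_right h hn1
      linarith
    have key : ((n : ℝ) - 1) * (B * Real.log (muConst n) + A * Real.log (lambdaConst 1) +
        Real.log (muConst n * (cfDen f (m + 1) * lambdaConst 1)) -
        (digitSum f m + A + B * (n + 1)) * Real.log (√2)) =
        kappaDen n * (kappaConst n * (m + A + 2 * B) - (digitSum f m + A + B * (n + 1))) + c₁ := by
      rw [hc₁]
      rw [kappaDen] at hkD ⊢
      linear_combination -((m : ℝ) + A + 2 * B) * hkD
    rw [key]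
    have h2 : kappaConst n * (m + A + 2 * B) - (digitSum f m + A + B * (n + 1)) ≤
        n - ψ (m + A) := by linarith
    nlinarith [mul_le_mul_of_nonneg_left h2 hD.le]

/-- Iterates the extension with growing targets `k` and takes the limit word. The seed is the single
digit `1`, whose bound is precisely the hypothesis on `ψ 1`. -/
theorem exists_oscillating_digits {n : ℕ} (hn : 5 ≤ n) {ψ : ℕ → ℝ} (hψ : Monotone ψ)
    (hψ' : Tendsto ψ atTop atTop) (hψ1 : 1 - kappaConst n ≤ ψ 1) :
    ∃ a : ℕ → ℕ, (∀ i, 1 ≤ a i) ∧ (∀ i, a i ≤ n) ∧ (∀ m, SumBounded n ψ a m) ∧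
      (∀ K, ∃ᶠ t in atTop, K ≤ slopeScale a t) ∧ ∃ᶠ t in atTop, slopeScale a t ≤ 1 := by
  let P : (ℕ → ℕ) × ℕ → Prop := fun s => 1 ≤ s.2 ∧ (∀ i, 1 ≤ s.1 i) ∧ (∀ i, s.1 i ≤ n) ∧
    SumBounded n ψ s.1 s.2
  have hstep : ∀ (s : {s // P s}) (k : ℕ), ∃ s' : {s // P s}, s.1.2 < s'.1.2 ∧
      (∀ i < s.1.2, s'.1.1 i = s.1.1 i) ∧
      (∃ t, s.1.2 ≤ t ∧ t ≤ s'.1.2 ∧ (k : ℝ) ≤ slopeScale s'.1.1 t) ∧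
      slopeScale s'.1.1 s'.1.2 ≤ 1 := by
    rintro ⟨⟨f, m⟩, hm, h1, h2, h3⟩ k
    obtain ⟨g, l, hl, hgf, hg1, hgn, hgb, ht, hs⟩ := exists_extension hn hψ hψ' hm h1 h2 h3 k
    exact ⟨⟨(g, l), by change 1 ≤ m at hm; change 1 ≤ l; omega, hg1, hgn, hgb⟩, hl, hgf, ht, hs⟩
  choose next hlt hagree hlarge hsmall using hstep
  have hinit : P (fun _ => 1, 1) := by
    refine ⟨le_rfl, fun _ => le_rfl, fun _ => by change 1 ≤ n; omega, fun t h1 h2 => ?_⟩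
    obtain rfl : t = 1 := le_antisymm h2 h1
    simp only [digitSum, Finset.sum_range_one, Nat.cast_one, mul_one]
    linarith
  let s : ℕ → {s // P s} := fun k => Nat.rec ⟨_, hinit⟩ (fun k s => next s k) k
  have hs : ∀ k, s (k + 1) = next (s k) k := fun _ => rfl
  have hlen : ∀ k, k < (s k).1.2 := by
    intro k
    induction k with
    | zero => exact Nat.zero_lt_one
    | succ k ih =>
      have := hlt (s k) k
      rw [hs]
      omega
  have hmono : ∀ k l, k ≤ l → (s k).1.2 ≤ (s l).1.2 ∧
      ∀ i < (s k).1.2, (s l).1.1 i = (s k).1.1 i := by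
    intro k l hkl
    induction l, hkl using Nat.le_induction with
    | base => exact ⟨le_rfl, fun _ _ => rfl⟩
    | succ l _ ih =>
      rw [hs]
      exact ⟨ih.1.trans (hlt _ _).le, fun i hi =>
        (hagree _ _ i (hi.trans_le ih.1)).trans (ih.2 i hi)⟩
  have hlimit : ∀ k, ∀ i < (s k).1.2, (s i).1.1 i = (s k).1.1 i := by
    intro k i hi
    rcases le_total i k with h | h
    · exact ((hmono i k h).2 i (hlen i)).symm
    · exact (hmono k i h).2 i hi
  -- Diagonal choice: stage `i` has more than `i` settled digits, by `hlen`.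
  refine ⟨fun i => (s i).1.1 i, fun i => (s i).2.2.1 i, fun i => (s i).2.2.2.1 i,
    fun m t ht _ => ?_, fun K => ?_, ?_⟩
  · rw [digitSum_congr (b := (s t).1.1) fun i hi => hlimit t i (hi.trans (hlen t))]
    exact (s t).2.2.2.2 t ht (hlen t).le
  · rw [frequently_atTop]
    intro N
    obtain ⟨k, hk⟩ := exists_nat_gt (max K N)
    have hkN : N < k := by exact_mod_cast (le_max_right K (N : ℝ)).trans_lt hk
    obtain ⟨t, ht1, ht2, ht3⟩ := hlarge (s k) k
    rw [← hs] at ht2 ht3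
    refine ⟨t, by have := hlen k; omega, ?_⟩
    rw [slopeScale_congr fun i hi => hlimit (k + 1) i (by omega)]
    exact ((le_max_left K (N : ℝ)).trans hk.le).trans ht3
  · rw [frequently_atTop]
    intro N
    refine ⟨(s (N + 1)).1.2, by have := hlen (N + 1); omega, ?_⟩
    rw [slopeScale_congr fun i hi => hlimit (N + 1) i hi, hs]
    exact hsmall (s N) N

/-! ### Proof of the theorem -/

theorem partialQuotientSum_eq {x : ℝ} {a : ℕ → ℕ} (h : ∀ t, partialQuotient x t = a t) (t : ℕ) :
    partialQuotientSum x t = digitSum a t := by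
  rw [partialQuotientSum, digitSum]
  push_cast
  exact Finset.sum_congr rfl fun i _ => h i

theorem theorem5 (n : ℕ) (hn : 5 ≤ n) :
    (∀ x ∈ boundedTypeSet n,
      (∃ C : ℝ, ∀ t : ℕ, 1 ≤ t → partialQuotientSum x t ≤ kappaConst n * (t : ℝ) + C) →
        HasExtendedDerivAt minkowskiQuestion ⊤ x) ∧
    (∀ ψ : ℕ → ℝ, Monotone ψ → Tendsto ψ atTop atTop → 1 - kappaConst n ≤ ψ 1 →
      ∃ x ∈ boundedTypeSet n,
        (¬ ∃ L : EReal, HasExtendedDerivAt minkowskiQuestion L x) ∧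
          ∀ t : ℕ, 1 ≤ t → partialQuotientSum x t ≤ kappaConst n * (t : ℝ) + ψ t) := by
  refine ⟨?_, ?_⟩
  · rintro x ⟨hirr, hI, hbd⟩ ⟨C, hC⟩
    obtain ⟨a, ha, hpq, hx⟩ := exists_digits hirr hI
    have han : ∀ t, a t ≤ n := fun t => by
      have := hbd t
      rw [hpq] at this
      exact_mod_cast this
    refine hasExtendedDerivAt_top_of_slopeScale ha han hx (tendsto_slopeScale hn ha han (C := C) ?_)
    intro t ht
    rw [← partialQuotientSum_eq hpq]
    exact hC t ht
  · intro ψ hψ hψ' hψ1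
    obtain ⟨a, ha, han, hS, hlarge, hsmall⟩ := exists_oscillating_digits hn hψ hψ' hψ1
    obtain ⟨x, hx⟩ := exists_forall_mem_cfCylinder ha
    have hpq := partialQuotient_eq_of_forall_mem ha hx
    refine ⟨x, ⟨irrational_of_forall_mem ha hx, ⟨?_, ?_⟩, fun j => ?_⟩,
      not_hasExtendedDerivAt_of_slopeScale ha han hx hlarge ⟨1, hsmall⟩, fun t ht => ?_⟩
    · have := cfErr_pos_of_forall_mem ha hx 1
      rwa [cfErr_one] at this
    · have := cfErr_lt_of_forall_mem ha hx 0
      rwa [zero_add, cfErr_one, cfErr_zero] at this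
    · rw [hpq]
      exact_mod_cast han j
    · rw [partialQuotientSum_eq hpq]
      exact hS t t ht le_rfl
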